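/- **Unification type.** Let $(P,\le)$ be a quasiordered set. A $\mu$-set of $P$ is an antichain $M\subseteq P$ (no two distinct elements of $M$ are comparable) such that every element of $P$ is below some element of $M$; any two $\mu$-sets of $P$ have the same cardinality. $P$ has type $1$ if it has a $\mu$-set with exactly one element, type $\omega$ if it has a finite $\mu$-set with more than one element, type $\infty$ if it has an infinite $\mu$-set, and type $0$ if it has no $\mu$-set. Let $\mathbf V$ be a variety of algebras and let $A$ be finitely presented relative to $\mathbf V$. A *unifier* of $A$ in $\mathbf V$ is a pair $(u,B)$ where $B\in\mathbf V$ is finitely presented relative to $\mathbf V$ and projective in $\mathbf V$ (with respect to surjective homomorphisms) and $u\colon A\to B$ is a homomorphism. $A$ is *unifiable* in $\mathbf V$ if it has a unifier. The unifier $(u,B)$ is more general than $(v,C)$ if $v=h\circ u$ for some homomorphism $h\colon B\to C$. Quasiorder the unifiers of $A$ by putting $(v,C)$ below $(u,B)$ when $(u,B)$ is more general than $(v,C)$; the type of $A$ in $\mathbf V$ is the type of this quasiordered collection. The *unification type* $t(\mathbf V)$ is: unitary if every unifiable finitely presented $A\in\mathbf V$ has type $1$; finitary if every such $A$ has type $1$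 or $\omega$ and some such $A$ has type $\omega$; infinitary if every such $A$ has type $1$, $\omega$ or $\infty$ and some such $A$ has type $\infty$; nullary if some such $A$ has type $0$. **The operator $\rho^*$.** An interior algebra is a Boolean algebra with a unary operation $g$ such that $g(a)\le a$, $g(g(a))=g(a)$, $g(a\cdot b)=g(a)\cdot g(b)$ and $g(1)=1$. For a Heyting algebra $L$, let $\mathrm{Fr}(L)$ be its free Boolean extension, i.e. the Boolean subalgebra of the power set of the set of prime ideals of $L$ generated by the image of the Stone embedding of $L$, with $L$ identified with that image. Every $a\in\mathrm{Fr}(L)$ can be written as $a=(-u_1+v_1)\cdots(-u_n+v_n)$ with $u_i,v_i\in L$; put $g_L(a)=(u_1\Rightarrow v_1)\cdots(u_n\Rightarrow v_n)$, which does not depend on the representation. Then $\mathcal B(L)=(\mathrm{Fr}(L),g_L)$ is an interior algebra. For a variety $\mathbf V$ of Heyting algebras let $\mathcal B[\mathbf V]=\{\mathcal B(L):L\in\mathbf V\}$, and let $\rho^*(\mathbf V)=\mathrm{Eq}(\mathcal B[\mathbf V])$ be the variety of interior algebras generated by $\mathcal B[\mathbf V]$. **Theorem.** Let $\mathbf V$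 be a variety of Heyting algebras such that $\rho^*(\mathbf V)$ is locally finite (every finitely generated algebra in $\rho^*(\mathbf V)$ is finite). Then $t(\mathbf V)=t(\rho^*(\mathbf V))$. -/

import Mathlib

universe u

namespace UnifType

open CategoryTheory
open scoped FirstOrder

/-! ### Unification type of a quasiordered set -/

/-- The four unification types `1`, `ω`, `∞`, `0`. -/
inductive UnificationType : Type
  | unitary
  | finitary
  | infinitary
  | nullary

/-- A `μ`-set of a quasiordered set: a dense antichain. -/
def IsMuSet {P : Type*} [Preorder P] (M : Set P) : Prop :=
  IsAntichain (· ≤ ·) M ∧ ∀ x : P, ∃ m ∈ M, x ≤ m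

/-- `QOHasType P τ`: the quasiordered set `P` has unification type `τ`. -/
def QOHasType (P : Type*) [Preorder P] : UnificationType → Prop
  | .unitary => ∃ M : Set P, IsMuSet M ∧ M.encard = 1
  | .finitary => ∃ M : Set P, IsMuSet M ∧ M.Finite ∧ 1 < M.encard
  | .infinitary => ∃ M : Set P, IsMuSet M ∧ M.Infinite
  | .nullary => ¬ ∃ M : Set P, IsMuSet M

/-- Auxiliary inequality for the fact that all `μ`-sets have the same cardinality. -/
theorem IsMuSet.encard_le {P : Type*} [Preorder P] {M N : Set P} (hM : IsMuSet M)
    (hN : IsMuSet N) : M.encard ≤ N.encard := by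
  choose f hfN hf using hN.2
  refine Function.Embedding.encard_le ⟨fun m : M => (⟨f m, hfN m⟩ : N), ?_⟩
  rintro ⟨a, ha⟩ ⟨b, hb⟩ hab
  have hab' : f a = f b := congrArg Subtype.val hab
  obtain ⟨c, hc, hfc⟩ := hM.2 (f a)
  have hac : a = c := hM.1.eq ha hc ((hf a).trans hfc)
  have hbc : b = c := hM.1.eq hb hc ((hf b).trans (hab' ▸ hfc))
  exact Subtype.ext (hac.trans hbc.symm)

/-- A quasiordered set has at most one unification type. -/
theorem QOHasType.unique {P : Type*} [Preorder P] {σ τ : UnificationType}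
    (hσ : QOHasType P σ) (hτ : QOHasType P τ) : σ = τ := by
  have key : ∀ {M N : Set P}, IsMuSet M → IsMuSet N → M.encard = N.encard :=
    fun hM hN => le_antisymm (hM.encard_le hN) (hN.encard_le hM)
  cases σ <;> cases τ <;> simp only [QOHasType] at hσ hτ <;> try rfl
  case unitary.finitary =>
    obtain ⟨M, hM, h1⟩ := hσ
    obtain ⟨N, hN, -, h2⟩ := hτ
    rw [← key hM hN, h1] at h2; exact absurd h2 (lt_irrefl _)
  case finitary.unitary =>
    obtain ⟨M, hM, h1⟩ := hτ
    obtain ⟨N, hN, -, h2⟩ := hσ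
    rw [← key hM hN, h1] at h2; exact absurd h2 (lt_irrefl _)
  case unitary.infinitary =>
    obtain ⟨M, hM, h1⟩ := hσ
    obtain ⟨N, hN, h2⟩ := hτ
    rw [← Set.encard_eq_top_iff, ← key hM hN, h1] at h2; exact absurd h2 (by simp)
  case infinitary.unitary =>
    obtain ⟨M, hM, h1⟩ := hτ
    obtain ⟨N, hN, h2⟩ := hσ
    rw [← Set.encard_eq_top_iff, ← key hM hN, h1] at h2; exact absurd h2 (by simp)
  case finitary.infinitary =>
    obtain ⟨M, hM, h1, -⟩ := hσ
    obtain ⟨N, hN, h2⟩ := hτ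
    rw [← Set.encard_eq_top_iff, ← key hM hN, Set.encard_eq_top_iff] at h2
    exact absurd h1 h2
  case infinitary.finitary =>
    obtain ⟨M, hM, h1, -⟩ := hτ
    obtain ⟨N, hN, h2⟩ := hσ
    rw [← Set.encard_eq_top_iff, ← key hM hN, Set.encard_eq_top_iff] at h2
    exact absurd h1 h2
  all_goals
    first
      | (obtain ⟨M, hM, -⟩ := hσ; exact absurd ⟨M, hM⟩ hτ)
      | (obtain ⟨M, hM, -⟩ := hτ; exact absurd ⟨M, hM⟩ hσ)

/-- A non-empty quasiordered set has a unification type. -/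
theorem QOHasType.exists {P : Type*} [Preorder P] [Nonempty P] :
    ∃ τ, QOHasType P τ := by
  by_cases h : ∃ M : Set P, IsMuSet M
  · obtain ⟨M, hM⟩ := h
    by_cases hf : M.Finite
    · by_cases h1 : M.encard = 1
      · exact ⟨.unitary, M, hM, h1⟩
      · refine ⟨.finitary, M, hM, hf, lt_of_le_of_ne ?_ (Ne.symm h1)⟩
        obtain ⟨m, hm, -⟩ := hM.2 (Classical.arbitrary P)
        exact Set.one_le_encard_iff_nonempty.2 ⟨m, hm⟩
    · exact ⟨.infinitary, M, hM, hf⟩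
  · exact ⟨.nullary, h⟩

/-! ### Classes of algebras, varieties -/

variable {L : FirstOrder.Language.{0, 0}}

/-- `A` satisfies the identity `e.1 ≈ e.2`. -/
def Satisfies (A : Bundled.{u} L.Structure) (e : L.Term ℕ × L.Term ℕ) : Prop :=
  ∀ v : ℕ → A, e.1.realize v = e.2.realize v

/-- The equational class axiomatised by a set of identities. -/
def Models (E : Set (L.Term ℕ × L.Term ℕ)) : Set (Bundled.{u} L.Structure) :=
  {A | ∀ e ∈ E, Satisfies A e}

/-- A variety is a class of algebras axiomatised by identities. -/
def IsVariety (K : Set (Bundled.{u} L.Structure)) : Prop :=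
  ∃ E : Set (L.Term ℕ × L.Term ℕ), K = Models E

/-- `Eq(K)`, the variety generated by `K`: all algebras satisfying every identity
that holds throughout `K`. -/
def Eqv (K : Set (Bundled.{u} L.Structure)) : Set (Bundled.{u} L.Structure) :=
  Models {e | ∀ A ∈ K, Satisfies A e}

/-- A class of algebras is locally finite if its finitely generated members are finite. -/
def IsLocallyFinite (K : Set (Bundled.{u} L.Structure)) : Prop :=
  ∀ A ∈ K, FirstOrder.Language.Structure.FG L A → Finite A

/-- `A` is finitely presented relative to `V`: it belongs to `V` and is presented in `V` by
finitely many generators `a 0, …, a (n - 1)` and finitely many relations `R`. -/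
def IsFinitelyPresented (V : Set (Bundled.{u} L.Structure)) (A : Bundled.{u} L.Structure) :
    Prop :=
  A ∈ V ∧ ∃ (n : ℕ) (R : Finset (L.Term (Fin n) × L.Term (Fin n))) (a : Fin n → A),
    (∀ e ∈ R, e.1.realize a = e.2.realize a) ∧
    ∀ B ∈ V, ∀ b : Fin n → B, (∀ e ∈ R, e.1.realize b = e.2.realize b) →
      ∃! h : A →[L] B, ∀ i, h (a i) = b i

/-- `P` is projective in `V`, with respect to surjective homomorphisms. -/
def IsProjective (V : Set (Bundled.{u} L.Structure)) (P : Bundled.{u} L.Structure) : Prop :=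
  P ∈ V ∧ ∀ A ∈ V, ∀ B ∈ V, ∀ (f : A →[L] B) (g : P →[L] B), Function.Surjective f →
    ∃ h : P →[L] A, f.comp h = g

/-! ### Unifiers and the unification type of a class of algebras -/

/-- A unifier for `A` in `V`: a homomorphism `u` from `A` to a member `B` of `V` which is finitely
presented and projective in `V`. -/
structure Unifier (V : Set (Bundled.{u} L.Structure)) (A : Bundled.{u} L.Structure) where
  B : Bundled.{u} L.Structure
  finitelyPresented : IsFinitelyPresented V B
  projective : IsProjective V B
  u : A →[L] B

/-- `x ≤ y` means that the unifier `y` is more general than the unifier `x`. -/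
instance (V : Set (Bundled.{u} L.Structure)) (A : Bundled.{u} L.Structure) :
    Preorder (Unifier V A) where
  le x y := ∃ h : y.B →[L] x.B, x.u = h.comp y.u
  le_refl x := ⟨FirstOrder.Language.Hom.id L x.B, by ext; rfl⟩
  le_trans x y z := by
    rintro ⟨h, hh⟩ ⟨k, hk⟩
    exact ⟨h.comp k, by rw [hh, hk]; rfl⟩

/-- `A` is a unifiable (in particular finitely presented) member of `V`. -/
def IsUnifiable (V : Set (Bundled.{u} L.Structure)) (A : Bundled.{u} L.Structure) : Prop :=
  IsFinitelyPresented V A ∧ Nonempty (Unifier V A)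

/-- `HasUnificationType V τ`: the class `V` has unification type `τ`. -/
def HasUnificationType (V : Set (Bundled.{u} L.Structure)) : UnificationType → Prop
  | .unitary => ∀ A, IsUnifiable V A → QOHasType (Unifier V A) .unitary
  | .finitary =>
      (∀ A, IsUnifiable V A →
        QOHasType (Unifier V A) .unitary ∨ QOHasType (Unifier V A) .finitary) ∧
      ∃ A, IsUnifiable V A ∧ QOHasType (Unifier V A) .finitary
  | .infinitary =>
      (∀ A, IsUnifiable V A →
        QOHasType (Unifier V A) .unitary ∨ QOHasType (Unifier V A) .finitary ∨
          QOHasType (Unifier V A) .infinitary) ∧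
      ∃ A, IsUnifiable V A ∧ QOHasType (Unifier V A) .infinitary
  | .nullary => ∃ A, IsUnifiable V A ∧ QOHasType (Unifier V A) .nullary

/-- Every class of algebras has exactly one unification type. -/
theorem existsUnique_hasUnificationType (V : Set (Bundled.{u} L.Structure)) :
    ∃! τ, HasUnificationType V τ := by
  have ex : ∀ A, IsUnifiable V A → ∃ τ, QOHasType (Unifier V A) τ := fun A hA =>
    haveI := hA.2
    QOHasType.exists
  have ne : ∀ {A : Bundled.{u} L.Structure} {σ τ}, QOHasType (Unifier V A) σ →
      QOHasType (Unifier V A) τ → σ = τ := fun h h' => h.unique h'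
  by_cases h0 : ∃ A, IsUnifiable V A ∧ QOHasType (Unifier V A) .nullary
  · refine ⟨.nullary, h0, ?_⟩
    obtain ⟨A, hA, hA0⟩ := h0
    rintro (_ | _ | _ | _) h
    · exact ne (h A hA) hA0
    · rcases h.1 A hA with h | h <;> cases ne h hA0
    · rcases h.1 A hA with h | h | h <;> cases ne h hA0
    · rfl
  by_cases h1 : ∃ A, IsUnifiable V A ∧ QOHasType (Unifier V A) .infinitary
  · refine ⟨.infinitary, ⟨fun A hA => ?_, h1⟩, ?_⟩
    · obtain ⟨_ | _ | _ | _, h⟩ := ex A hA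
      · exact .inl h
      · exact .inr (.inl h)
      · exact .inr (.inr h)
      · exact absurd ⟨A, hA, h⟩ h0
    · obtain ⟨A, hA, hA1⟩ := h1
      rintro (_ | _ | _ | _) h
      · exact ne (h A hA) hA1
      · rcases h.1 A hA with h | h <;> cases ne h hA1
      · rfl
      · exact absurd h h0
  by_cases h2 : ∃ A, IsUnifiable V A ∧ QOHasType (Unifier V A) .finitary
  · refine ⟨.finitary, ⟨fun A hA => ?_, h2⟩, ?_⟩
    · obtain ⟨_ | _ | _ | _, h⟩ := ex A hA
      · exact .inl h
      · exact .inr h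
      · exact absurd ⟨A, hA, h⟩ h1
      · exact absurd ⟨A, hA, h⟩ h0
    · obtain ⟨A, hA, hA1⟩ := h2
      rintro (_ | _ | _ | _) h
      · exact ne (h A hA) hA1
      · rfl
      · exact absurd h.2 h1
      · exact absurd h h0
  · refine ⟨.unitary, fun A hA => ?_, ?_⟩
    · obtain ⟨_ | _ | _ | _, h⟩ := ex A hA
      · exact h
      · exact absurd ⟨A, hA, h⟩ h2
      · exact absurd ⟨A, hA, h⟩ h1
      · exact absurd ⟨A, hA, h⟩ h0
    · rintro (_ | _ | _ | _) h
      · rfl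
      · exact absurd h.2 h2
      · exact absurd h.2 h1
      · exact absurd h h0

/-- `t(V)`, the unification type of `V`. -/
noncomputable def unificationType (V : Set (Bundled.{u} L.Structure)) : UnificationType :=
  (existsUnique_hasUnificationType V).choose

/-- `t(V)` is the type that `V` has. -/
theorem hasUnificationType_iff (V : Set (Bundled.{u} L.Structure)) (τ : UnificationType) :
    HasUnificationType V τ ↔ unificationType V = τ := by
  have h := (existsUnique_hasUnificationType V).choose_spec
  exact ⟨fun hτ => (h.2 τ hτ).symm, fun hτ => hτ ▸ h.1⟩

/-! ### Heyting algebras and interior algebras as algebras over a signature -/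

/-- The operations of Heyting algebras. -/
inductive HeytingOp : ℕ → Type
  | bot : HeytingOp 0
  | top : HeytingOp 0
  | inf : HeytingOp 2
  | sup : HeytingOp 2
  | imp : HeytingOp 2

/-- The signature of Heyting algebras. -/
def heytingSig : FirstOrder.Language.{0, 0} := ⟨HeytingOp, fun _ => Empty⟩

/-- A Heyting algebra as an algebra over the Heyting signature. -/
abbrev heytingStructure (H : Type u) [HeytingAlgebra H] : heytingSig.Structure H where
  funMap {_} f := match f with
    | .bot => fun _ => ⊥
    | .top => fun _ => ⊤
    | .inf => fun v => v 0 ⊓ v 1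
    | .sup => fun v => v 0 ⊔ v 1
    | .imp => fun v => v 0 ⇨ v 1
  RelMap r := r.elim

/-- The class `HA` of all Heyting algebras. -/
def HA : Set (Bundled.{u} heytingSig.Structure) :=
  {A | ∃ _ : HeytingAlgebra A, A.str = heytingStructure A}

/-- An interior algebra: a Boolean algebra with an interior operator `g`. -/
class InteriorAlgebra (B : Type u) extends BooleanAlgebra B where
  g : B → B
  g_le : ∀ a, g a ≤ a
  g_idem : ∀ a, g (g a) = g a
  g_inf : ∀ a b, g (a ⊓ b) = g a ⊓ g b
  g_top : g ⊤ = ⊤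

/-- The operations of interior algebras. -/
inductive InteriorOp : ℕ → Type
  | bot : InteriorOp 0
  | top : InteriorOp 0
  | inf : InteriorOp 2
  | sup : InteriorOp 2
  | compl : InteriorOp 1
  | interior : InteriorOp 1

/-- The signature of interior algebras. -/
def interiorSig : FirstOrder.Language.{0, 0} := ⟨InteriorOp, fun _ => Empty⟩

/-- An interior algebra as an algebra over the signature of interior algebras. -/
abbrev interiorStructure (B : Type u) [InteriorAlgebra B] : interiorSig.Structure B where
  funMap {_} f := match f with
    | .bot => fun _ => ⊥
    | .top => fun _ => ⊤
    | .inf => fun v => v 0 ⊓ v 1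
    | .sup => fun v => v 0 ⊔ v 1
    | .compl => fun v => (v 0)ᶜ
    | .interior => fun v => InteriorAlgebra.g (v 0)
  RelMap r := r.elim

/-! ### The free Boolean extension and its interior operator -/

section FreeBooleanExtension

variable (D : Type u) [HeytingAlgebra D]

/-- The set of prime ideals. -/
abbrev PrimeIdeals : Type u := {I : Order.Ideal D // I.IsPrime}

variable {D} in
/-- The Stone embedding into the power set of the set of prime ideals. -/
def stone (a : D) : Set (PrimeIdeals D) := {I | a ∉ I.1}

/-- The free Boolean extension: the Boolean subalgebra of the power set of the set of prime ideals
generated by the image of the Stone embedding. -/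
abbrev Fr : Type u := BooleanSubalgebra.closure (Set.range (stone (D := D)))

variable {D}

/-- The embedding of a Heyting algebra into its free Boolean extension. -/
def toFr (a : D) : Fr D := ⟨stone a, BooleanSubalgebra.subset_closure ⟨a, rfl⟩⟩

theorem stone_inf (a b : D) : stone (a ⊓ b) = stone a ⊓ stone b := by
  ext I
  have hI := I.2
  simp only [stone, Set.mem_ofPred_eq, Set.inf_eq_inter, Set.mem_inter_iff]
  constructor
  · exact fun h => ⟨fun ha => h (I.1.lower inf_le_left ha), fun hb => h (I.1.lower inf_le_right hb)⟩
  · exact fun h hab => (hI.mem_or_mem hab).elim h.1 h.2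

theorem stone_sup (a b : D) : stone (a ⊔ b) = stone a ⊔ stone b := by
  ext I
  simp only [stone, Set.mem_ofPred_eq, Set.sup_eq_union, Set.mem_union, Order.Ideal.sup_mem_iff]
  tauto

theorem stone_bot : stone (⊥ : D) = ⊥ := by
  ext I
  simp [stone]

theorem stone_top : stone (⊤ : D) = ⊤ := by
  ext I
  have hI := I.2.toIsProper
  simpa [stone] using hI.top_notMem

theorem stone_le_stone {a b : D} : stone a ≤ stone b ↔ a ≤ b := by
  constructor
  · intro h
    by_contra hab
    have hd : Disjoint ((Order.PFilter.principal a : Order.PFilter D) : Set D)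
        ((Order.Ideal.principal b : Order.Ideal D) : Set D) := by
      rw [Set.disjoint_left]
      intro x hx hx'
      have h1 : a ≤ x := Order.PFilter.mem_principal.1 hx
      exact hab (h1.trans (Order.Ideal.mem_principal.1 hx'))
    obtain ⟨J, hJ, hbJ, haJ⟩ := DistribLattice.prime_ideal_of_disjoint_filter_ideal hd
    have ha : a ∉ J := fun ha =>
      Set.disjoint_left.1 haJ (Order.PFilter.mem_principal.2 le_rfl) ha
    have h2 : (⟨J, hJ⟩ : PrimeIdeals D) ∈ stone b := h (show a ∉ J from ha)
    exact h2 (hbJ (Order.Ideal.mem_principal.2 le_rfl))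
  · exact fun h I ha hb => ha (I.1.lower h hb)

theorem toFr_le_toFr {a b : D} : toFr a ≤ toFr b ↔ a ≤ b := stone_le_stone

theorem toFr_inf (a b : D) : toFr (a ⊓ b) = toFr a ⊓ toFr b := Subtype.ext (stone_inf a b)

theorem toFr_sup (a b : D) : toFr (a ⊔ b) = toFr a ⊔ toFr b := Subtype.ext (stone_sup a b)

theorem toFr_bot : toFr (⊥ : D) = ⊥ := Subtype.ext stone_bot

theorem toFr_top : toFr (⊤ : D) = ⊤ := Subtype.ext stone_top

/-- The element `(-u₁ + v₁) · … · (-uₙ + vₙ)` of the free Boolean extension. -/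
def conj (t : Finset (D × D)) : Fr D := t.inf fun p => (toFr p.1)ᶜ ⊔ toFr p.2

/-- The element `(u₁ ⇨ v₁) ⊓ … ⊓ (uₙ ⇨ vₙ)` of the Heyting algebra. -/
def himps (t : Finset (D × D)) : D := t.inf fun p => p.1 ⇨ p.2

theorem toFr_le_conj (t : Finset (D × D)) (x : D) : toFr x ≤ conj t ↔ x ≤ himps t := by
  simp only [conj, himps, Finset.le_inf_iff]
  refine forall₂_congr fun p _ => ?_
  rw [le_himp_iff, ← toFr_le_toFr (a := x ⊓ p.1), toFr_inf, sup_comm, ← himp_eq, le_himp_iff]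

/-- Every element of the free Boolean extension has the form `(-u₁ + v₁) · … · (-uₙ + vₙ)`. -/
theorem exists_eq_conj (a : Fr D) : ∃ t : Finset (D × D), a = conj t := by
  classical
  suffices h : ∀ s : Set (PrimeIdeals D),
      s ∈ BooleanSubalgebra.closure (Set.range (stone (D := D))) →
      ∃ t : Finset (D × D), s = (conj t : Fr D).1 by
    obtain ⟨t, ht⟩ := h a.1 a.2
    exact ⟨t, Subtype.ext ht⟩
  have hc : ∀ t : Finset (D × D), (conj t : Fr D).1 = t.inf fun p => (stone p.1)ᶜ ⊔ stone p.2 := by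
    intro t
    induction t using Finset.induction_on with
    | empty => rfl
    | insert p t hp ih =>
      have h1 : (conj (insert p t) : Fr D) = ((toFr p.1)ᶜ ⊔ toFr p.2) ⊓ conj t := by
        simp only [conj, Finset.inf_insert]
      rw [h1, Finset.inf_insert, ← ih]
      rfl
  intro s hs
  have hmem := BooleanSubalgebra.compl_mem hs
  have hsub : IsSublattice (Set.range (stone (D := D))) :=
    ⟨by rintro _ ⟨a, rfl⟩ _ ⟨b, rfl⟩; exact ⟨a ⊔ b, stone_sup a b⟩,
      by rintro _ ⟨a, rfl⟩ _ ⟨b, rfl⟩; exact ⟨a ⊓ b, stone_inf a b⟩⟩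
  have hbot : (⊥ : Set (PrimeIdeals D)) ∈ Set.range (stone (D := D)) := ⟨⊥, stone_bot⟩
  have htop : (⊤ : Set (PrimeIdeals D)) ∈ Set.range (stone (D := D)) := ⟨⊤, stone_top⟩
  rw [BooleanSubalgebra.mem_closure_iff_sup_sdiff hsub hbot htop] at hmem
  obtain ⟨t, ht⟩ := hmem
  refine ⟨t.image fun x => (x.1.2.choose, x.2.2.choose), ?_⟩
  rw [hc, Finset.inf_image, ← compl_compl s, ht, Finset.compl_sup]
  refine Finset.inf_congr rfl fun x _ => ?_
  simp only [Function.comp, x.1.2.choose_spec, x.2.2.choose_spec, compl_sdiff, himp_eq, sup_comm]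

/-- The value `g_D(a)`, as an element of the Heyting algebra `D`. -/
noncomputable def openPart (a : Fr D) : D := himps (exists_eq_conj a).choose

theorem toFr_le_iff (a : Fr D) (x : D) : toFr x ≤ a ↔ x ≤ openPart a := by
  conv_lhs => rw [(exists_eq_conj a).choose_spec]
  exact toFr_le_conj _ x

/-- `g_D((-u₁ + v₁) · … · (-uₙ + vₙ)) = (u₁ ⇨ v₁) ⊓ … ⊓ (uₙ ⇨ vₙ)`, for every representation. -/
theorem openPart_conj (t : Finset (D × D)) : openPart (conj t) = himps t :=
  eq_of_forall_le_iff fun x => by rw [← toFr_le_iff, toFr_le_conj]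

theorem openPart_toFr (x : D) : openPart (toFr x) = x :=
  eq_of_forall_le_iff fun y => by rw [← toFr_le_iff, toFr_le_toFr]

/-- `B(D)`: the free Boolean extension with the interior operator `g_D`. -/
noncomputable instance : InteriorAlgebra (Fr D) where
  g a := toFr (openPart a)
  g_le a := (toFr_le_iff a _).2 le_rfl
  g_idem a := by rw [openPart_toFr]
  g_inf a b := by
    rw [← toFr_inf]
    congr 1
    exact eq_of_forall_le_iff fun x => by
      rw [← toFr_le_iff, le_inf_iff, le_inf_iff, toFr_le_iff, toFr_le_iff]
  g_top := by
    rw [← toFr_top, openPart_toFr]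

end FreeBooleanExtension

/-- The class `B[V] = {B(D) : D ∈ V}` of interior algebras. -/
def BImage (V : Set (Bundled.{u} heytingSig.Structure)) :
    Set (Bundled.{u} interiorSig.Structure) :=
  {A | ∃ (D : Type u) (_ : HeytingAlgebra D),
    (⟨D, heytingStructure D⟩ : Bundled.{u} heytingSig.Structure) ∈ V ∧
      A = ⟨Fr D, interiorStructure (Fr D)⟩}

/-- `ρ*(V) = Eq(B[V])`. -/
def rhoStar (V : Set (Bundled.{u} heytingSig.Structure)) :
    Set (Bundled.{u} interiorSig.Structure) :=
  Eqv (BImage V)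

end UnifType

universe v

namespace UnifType

open CategoryTheory FirstOrder FirstOrder.Language
open scoped FirstOrder

/-! ### Transport of unification types along a correspondence of quasiordered sets -/

section Transport

variable {P : Type*} {Q : Type*} [Preorder P] [Preorder Q] {R : P → Q → Prop}

/-! The operator `B` matches the finite members of `V` with the finite members of `ρ*(V)`, and local
finiteness reduces unification to finite algebras.

An inequality between products of clauses `-u + v` is decided by the order of the lattice alone
(`impInf_le_of_embedding`), so lattice homomorphisms extend to free Boolean extensions. Since `g`
turns a clause into an implication, extensions of Heyting homomorphisms commute with `g`. Conversely
the open elements of `B(L)` are exactly those of `L`, so homomorphisms restrict. Thus `B` is full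
and faithful, and preserves and reflects surjectivity.

Every `B(L)` satisfies the Grzegorczyk inequality, which is an identity and so holds in `ρ*(V)`. A
finite interior algebra satisfying it is generated by its open elements
(`isFreeExtension_opensHom`), hence is `B` of them. These form a member of `V`, because Gödel
translations of the identities of `V` hold in `ρ*(V)` (`mem_of_isFreeExtension`).

Local finiteness descends to `V`. In both varieties finitely presented then means finite, and
projectivity of a finite algebra can be tested on finite algebras, so `B` matches the finite
projectives. Unifiers correspond, with their quasiorder preserved and reflected, and the types
agree. -/

theorem IsMuSet.transport (hle : ∀ {p q p' q'}, R p q → R p' q' → (p ≤ p' ↔ q ≤ q'))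
    (hP : ∀ p, ∃ q, R p q) (hQ : ∀ q, ∃ p, R p q) {M : Set P} (hM : IsMuSet M) :
    ∃ N : Set Q, IsMuSet N ∧ N.encard = M.encard := by
  -- `R` need not be a function, since unifiers match only up to isomorphism. Any choice works: all
  -- partners of `p` are equivalent in `Q`.
  choose f hf using hP
  have hff : ∀ {p p'}, f p ≤ f p' ↔ p ≤ p' := fun {p p'} => (hle (hf p) (hf p')).symm
  refine ⟨f '' M, ⟨?_, fun q => ?_⟩, Set.InjOn.encard_image fun a ha b hb hab => ?_⟩
  · rintro _ ⟨a, ha, rfl⟩ _ ⟨b, hb, rfl⟩ hne hab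
    exact hM.1 ha hb (fun h => hne (h ▸ rfl)) (hff.1 hab)
  · obtain ⟨p, hp⟩ := hQ q
    obtain ⟨m, hm, hpm⟩ := hM.2 p
    exact ⟨f m, ⟨m, hm, rfl⟩, (hle hp (hf m)).1 hpm⟩
  · exact hM.1.eq ha hb (hff.1 hab.le)

theorem QOHasType.transport (hle : ∀ {p q p' q'}, R p q → R p' q' → (p ≤ p' ↔ q ≤ q'))
    (hP : ∀ p, ∃ q, R p q) (hQ : ∀ q, ∃ p, R p q) {τ : UnificationType} (h : QOHasType P τ) :
    QOHasType Q τ := by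
  cases τ with
  | unitary =>
    obtain ⟨M, hM, h1⟩ := h
    obtain ⟨N, hN, h2⟩ := hM.transport hle hP hQ
    exact ⟨N, hN, h2.trans h1⟩
  | finitary =>
    obtain ⟨M, hM, hf, h1⟩ := h
    obtain ⟨N, hN, h2⟩ := hM.transport hle hP hQ
    exact ⟨N, hN, by rwa [← Set.encard_ne_top_iff, h2, Set.encard_ne_top_iff], h2 ▸ h1⟩
  | infinitary =>
    obtain ⟨M, hM, h1⟩ := h
    obtain ⟨N, hN, h2⟩ := hM.transport hle hP hQ
    exact ⟨N, hN, by rwa [← Set.encard_eq_top_iff, h2, Set.encard_eq_top_iff]⟩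
  | nullary =>
    rintro ⟨N, hN⟩
    -- A μ-set of `Q` would pull back along the converse relation.
    obtain ⟨M, hM, -⟩ := hN.transport (R := fun q p => R p q)
      (fun h h' => (hle h h').symm) hQ hP
    exact h ⟨M, hM⟩

theorem qoHasType_congr (hle : ∀ {p q p' q'}, R p q → R p' q' → (p ≤ p' ↔ q ≤ q'))
    (hP : ∀ p, ∃ q, R p q) (hQ : ∀ q, ∃ p, R p q) (τ : UnificationType) :
    QOHasType P τ ↔ QOHasType Q τ :=
  ⟨fun h => h.transport hle hP hQ,
    fun h => h.transport (R := fun q p => R p q) (fun h h' => (hle h h').symm) hQ hP⟩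

end Transport

/-- Classes of algebras whose unifiable members have the same types have the same type. -/
theorem unificationType_congr {L₁ L₂ : FirstOrder.Language.{0, 0}}
    {V : Set (Bundled.{u} L₁.Structure)} {W : Set (Bundled.{v} L₂.Structure)}
    (hVW : ∀ A, IsUnifiable V A → ∃ B, IsUnifiable W B ∧
      ∀ τ, QOHasType (Unifier V A) τ ↔ QOHasType (Unifier W B) τ)
    (hWV : ∀ B, IsUnifiable W B → ∃ A, IsUnifiable V A ∧
      ∀ τ, QOHasType (Unifier V A) τ ↔ QOHasType (Unifier W B) τ) :
    unificationType V = unificationType W := by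
  -- The predicate `p` ranges over conditions on the set of types of one algebra, which covers the
  -- universal clause of each unification type. As the type of `V` is unique, passing from `W` to
  -- `V` suffices.
  have hall : ∀ {p : (UnificationType → Prop) → Prop},
      (∀ B, IsUnifiable W B → p (QOHasType (Unifier W B))) →
      ∀ A, IsUnifiable V A → p (QOHasType (Unifier V A)) := by
    intro p h A hA
    obtain ⟨B, hB, hAB⟩ := hVW A hA
    rw [show QOHasType (Unifier V A) = QOHasType (Unifier W B) from
      funext fun τ => propext (hAB τ)]
    exact h B hB
  have hex : ∀ {τ}, (∃ B, IsUnifiable W B ∧ QOHasType (Unifier W B) τ) →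
      ∃ A, IsUnifiable V A ∧ QOHasType (Unifier V A) τ := by
    rintro τ ⟨B, hB, h⟩
    obtain ⟨A, hA, hAB⟩ := hWV B hB
    exact ⟨A, hA, (hAB τ).2 h⟩
  have h := (hasUnificationType_iff W _).2 rfl
  refine (hasUnificationType_iff V _).1 ?_
  revert h
  generalize unificationType W = τ
  cases τ with
  | unitary => exact fun h => hall (p := fun q => q .unitary) h
  | finitary =>
    exact fun h => ⟨hall (p := fun q => q .unitary ∨ q .finitary) h.1, hex h.2⟩
  | infinitary =>
    exact fun h =>
      ⟨hall (p := fun q => q .unitary ∨ q .finitary ∨ q .infinitary) h.1, hex h.2⟩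
  | nullary => exact hex

/-! ### Locally finite equational classes -/

section LocallyFinite

variable {L : FirstOrder.Language.{0, 0}} {K : Set (Bundled.{u} L.Structure)}

theorem IsVariety.substructure_mem (hK : IsVariety K) {A : Bundled.{u} L.Structure} (hA : A ∈ K)
    (S : L.Substructure A) : (⟨S, inferInstance⟩ : Bundled.{u} L.Structure) ∈ K := by
  obtain ⟨E, rfl⟩ := hK
  intro e he v
  have h := hA e he (S.subtype ∘ v)
  rw [HomClass.realize_term, HomClass.realize_term] at h
  exact S.subtype.injective h

theorem IsLocallyFinite.finite_closure (hlf : IsLocallyFinite K) (hK : IsVariety K)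
    {A : Bundled.{u} L.Structure} (hA : A ∈ K) {s : Set A} (hs : s.Finite) :
    Finite (Substructure.closure L s) :=
  hlf _ (hK.substructure_mem hA _)
    ((Substructure.fg_iff_structure_fg _).1 (Substructure.fg_closure hs))

/-- The subalgebra spanned by the presenting generators satisfies the relations, so `A` maps to it.
Followed by the inclusion this map fixes the generators, hence is the identity. -/
theorem IsFinitelyPresented.fg (hK : IsVariety K) {A : Bundled.{u} L.Structure}
    (hA : IsFinitelyPresented K A) : Structure.FG L A := by
  obtain ⟨hAK, n, R, a, haR, huniv⟩ := hA
  have ha : ∀ i, a i ∈ Substructure.closure L (Set.range a) :=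
    fun i => Substructure.subset_closure ⟨i, rfl⟩
  set S := Substructure.closure L (Set.range a)
  let a' : Fin n → S := fun i => ⟨a i, ha i⟩
  obtain ⟨h, hh, -⟩ := huniv ⟨S, inferInstance⟩ (hK.substructure_mem hAK S) a' fun e he => by
    have h1 := haR e he
    rw [show a = S.subtype ∘ a' from rfl, HomClass.realize_term, HomClass.realize_term] at h1
    exact S.subtype.injective h1
  have hid : S.subtype.toHom.comp h = Hom.id L A :=
    (huniv A hAK a haR).unique (fun i => congrArg Subtype.val (hh i)) fun i => rfl
  refine Structure.fg_iff.2 ⟨Set.range a, Set.finite_range a, top_unique fun x _ => ?_⟩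
  have hx : ((h x : S) : A) = x := DFunLike.congr_fun hid x
  exact hx ▸ (h x : S).2

/-- The operation tables are a presentation: all elements are generators, and each entry of a table
is a relation. -/
theorem isFinitelyPresented_of_finite [L.IsAlgebraic] [Finite (Σ n, L.Functions n)]
    {A : Bundled.{u} L.Structure} (hA : A ∈ K) [Finite A] : IsFinitelyPresented K A := by
  classical
  refine ⟨hA, ?_⟩
  obtain ⟨n, ⟨e⟩⟩ := Finite.exists_equiv_fin A
  let r : (Σ f : Σ n, L.Functions n, Fin f.1 → A) → L.Term (Fin n) × L.Term (Fin n) := fun p =>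
    (.func p.1.2 fun i => .var (e (p.2 i)), .var (e (Structure.funMap p.1.2 p.2)))
  refine ⟨n, (Set.finite_range r).toFinset, e.symm, ?_, fun B _ b hb => ?_⟩
  · simp only [Set.Finite.mem_toFinset, Set.forall_mem_range]
    intro p
    simp [r, Term.realize]
  · simp only [Set.Finite.mem_toFinset, Set.forall_mem_range] at hb
    refine ⟨⟨fun x => b (e x), fun {k} f x => ?_, fun r => isEmptyElim r⟩, fun i => ?_,
      fun h hh => ?_⟩
    · exact (hb ⟨⟨k, f⟩, x⟩).symm
    · exact congrArg b (e.apply_symm_apply i)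
    · ext x
      exact (congrArg h (e.symm_apply_apply x).symm).trans (hh (e x))

theorem isFinitelyPresented_iff_finite [L.IsAlgebraic] [Finite (Σ n, L.Functions n)]
    (hK : IsVariety K) (hlf : IsLocallyFinite K) {A : Bundled.{u} L.Structure} :
    IsFinitelyPresented K A ↔ A ∈ K ∧ Finite A :=
  ⟨fun h => ⟨h.1, hlf A h.1 (h.fg hK)⟩, fun h => have := h.2; isFinitelyPresented_of_finite h.1⟩

/-- In a locally finite variety, projectivity of a finite algebra can be tested on finite
algebras. -/
theorem isProjective_of_finite (hK : IsVariety K) (hlf : IsLocallyFinite K)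
    {P : Bundled.{u} L.Structure} (hP : P ∈ K) [Finite P]
    (h : ∀ A ∈ K, ∀ B ∈ K, Finite A → Finite B → ∀ (f : A →[L] B) (g : P →[L] B),
      Function.Surjective f → ∃ h : P →[L] A, f.comp h = g) : IsProjective K P := by
  refine ⟨hP, fun A hA B hB f g hf => ?_⟩
  -- One preimage of each `g p` is enough: these finitely many elements generate a finite subalgebra
  -- that `f` maps onto the range of `g`.
  let s : Set A := Set.range fun p => Function.surjInv hf (g p)
  let S := Substructure.closure L s
  have hS : Finite S := hlf.finite_closure hK hA (Set.finite_range _)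
  have hfS : ∀ x : S, f x ∈ g.range := by
    have : S ≤ g.range.comap f := by
      rw [Substructure.closure_le]
      rintro _ ⟨p, rfl⟩
      exact Hom.mem_range.2 ⟨p, (Function.surjInv_eq hf (g p)).symm⟩
    exact fun x => this x.2
  let f' : S →[L] g.range := (f.domRestrict S).codRestrict _ hfS
  let g' : P →[L] g.range := g.codRestrict _ g.mem_range_self
  have hf' : Function.Surjective f' := by
    rintro ⟨_, p, rfl⟩
    exact ⟨⟨_, Substructure.subset_closure ⟨p, rfl⟩⟩,
      Subtype.ext (Function.surjInv_eq hf (g p))⟩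
  have hfin : Finite g.range := Finite.of_surjective f' hf'
  obtain ⟨k, hk⟩ := h ⟨S, inferInstance⟩ (hK.substructure_mem hA S) ⟨g.range, inferInstance⟩
    (hK.substructure_mem hB _) hS hfin f' g' hf'
  refine ⟨S.subtype.toHom.comp k, ?_⟩
  ext p
  exact congrArg Subtype.val (DFunLike.congr_fun hk p)

end LocallyFinite

/-! ### Free Boolean extensions -/

section ImpInf

variable {α β γ : Type*} [BooleanAlgebra β] [BooleanAlgebra γ]

/-- The Boolean combination `(-ι u₁ + ι v₁) · … · (-ι uₙ + ι vₙ)`. -/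
def impInf (ι : α → β) (t : Finset (α × α)) : β := t.inf fun p => (ι p.1)ᶜ ⊔ ι p.2

theorem impInf_insert [DecidableEq α] (ι : α → β) (p : α × α) (t : Finset (α × α)) :
    impInf ι (insert p t) = ((ι p.1)ᶜ ⊔ ι p.2) ⊓ impInf ι t := by
  simp [impInf]

theorem impInf_union [DecidableEq α] (ι : α → β) (s t : Finset (α × α)) :
    impInf ι (s ∪ t) = impInf ι s ⊓ impInf ι t := Finset.inf_union

theorem impInf_singleton (ι : α → β) (p : α × α) : impInf ι {p} = (ι p.1)ᶜ ⊔ ι p.2 := by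
  simp [impInf]

variable [HeytingAlgebra α]

theorem impInf_top_left (ι : BoundedLatticeHom α β) (a : α) : impInf ι {(⊤, a)} = ι a := by
  simp [impInf_singleton]

/-- By distributivity, since the join of the clauses `-u + v` and `-u' + v'` is the clause `-(u ·
u') + (v + v')`. -/
theorem impInf_sup_impInf [DecidableEq α] (ι : BoundedLatticeHom α β) (s t : Finset (α × α)) :
    impInf ι s ⊔ impInf ι t =
      impInf ι ((s ×ˢ t).image fun p => (p.1.1 ⊓ p.2.1, p.1.2 ⊔ p.2.2)) := by
  rw [impInf, impInf, Finset.inf_sup_inf, impInf, Finset.inf_image]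
  refine Finset.inf_congr rfl fun p _ => ?_
  simp only [Function.comp, map_inf, map_sup, compl_inf]
  ac_rfl

theorem exists_compl_impInf (ι : BoundedLatticeHom α β) (t : Finset (α × α)) :
    ∃ s, (impInf ι t)ᶜ = impInf ι s := by
  classical
  induction t using Finset.induction_on with
  | empty => exact ⟨{(⊤, ⊥)}, by simp [impInf]⟩
  | insert p t _ ih =>
    obtain ⟨s, hs⟩ := ih
    have hp : ((ι p.1)ᶜ ⊔ ι p.2)ᶜ = impInf ι {(⊤, p.1), (p.2, ⊥)} := by
      simp [impInf]
    rw [impInf_insert, compl_inf, hs, hp, impInf_sup_impInf]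
    exact ⟨_, rfl⟩

/-- Eliminates one clause: what is left are two inequalities in which `u` and `v` occur without
complement. -/
theorem imp_inf_inf_le_iff (u v c x y : β) :
    (uᶜ ⊔ v) ⊓ c ⊓ x ≤ y ↔ c ⊓ x ≤ y ⊔ u ∧ c ⊓ (x ⊓ v) ≤ y := by
  have h1 : uᶜ ⊓ (c ⊓ x) ≤ y ↔ c ⊓ x ≤ y ⊔ u := by
    rw [inf_comm, ← sdiff_eq, sdiff_le_iff, sup_comm]
  rw [inf_assoc, inf_sup_right, sup_le_iff, h1,
    show v ⊓ (c ⊓ x) = c ⊓ (x ⊓ v) by ac_rfl]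

/-- Eliminating the clauses one at a time, with `u` and `v` varying, reduces the hypothesis to
inequalities `ι u ≤ ι v`. These hold in `α` already and are preserved by `φ`; the same eliminations
run backwards in `γ`. -/
theorem impInf_inf_le_of_embedding {ι : BoundedLatticeHom α β} (hι : ∀ {a b}, ι a ≤ ι b → a ≤ b)
    (φ : BoundedLatticeHom α γ) (t : Finset (α × α)) {u v : α} (h : impInf ι t ⊓ ι u ≤ ι v) :
    impInf φ t ⊓ φ u ≤ φ v := by
  classical
  induction t using Finset.induction_on generalizing u v with
  | empty =>
    have huv : u ≤ v := hι (by simpa [impInf] using h)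
    simpa [impInf] using OrderHomClass.mono φ huv
  | insert p t _ ih =>
    rw [impInf_insert, imp_inf_inf_le_iff, ← map_sup, ← map_inf] at h ⊢
    exact ⟨ih h.1, ih h.2⟩

theorem impInf_le_of_embedding {ι : BoundedLatticeHom α β} (hι : ∀ {a b}, ι a ≤ ι b → a ≤ b)
    (φ : BoundedLatticeHom α γ) {s t : Finset (α × α)} (h : impInf ι s ≤ impInf ι t) :
    impInf φ s ≤ impInf φ t := by
  refine Finset.le_inf fun p hp => ?_
  have h1 := h.trans (Finset.inf_le hp)
  rw [sup_comm, ← himp_eq, le_himp_iff] at h1 ⊢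
  exact impInf_inf_le_of_embedding hι φ s h1

/-- Bounded lattice homomorphisms extend to the generated Boolean algebra. -/
theorem exists_extension {ι : BoundedLatticeHom α β} (hι : ∀ {a b}, ι a ≤ ι b → a ≤ b)
    (hgen : ∀ b, ∃ t, b = impInf ι t) (φ : BoundedLatticeHom α γ) :
    ∃ F : BoundedLatticeHom β γ, ∀ t, F (impInf ι t) = impInf φ t := by
  classical
  choose r hr using hgen
  -- The value does not depend on the chosen representation.
  have hF : ∀ {b t}, b = impInf ι t → impInf φ (r b) = impInf φ t := fun {b t} h =>
    le_antisymm (impInf_le_of_embedding hι φ ((hr b).symm.trans h).le)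
      (impInf_le_of_embedding hι φ ((hr b).symm.trans h).ge)
  refine ⟨{ toFun := fun b => impInf φ (r b), map_sup' := fun a b => ?_, map_inf' := fun a b => ?_,
            map_top' := ?_, map_bot' := ?_ }, fun t => hF rfl⟩
  · rw [impInf_sup_impInf]
    refine hF ?_
    rw [← impInf_sup_impInf, ← hr, ← hr]
  · rw [← impInf_union]
    refine hF ?_
    rw [impInf_union, ← hr, ← hr]
  · exact (hF (t := ∅) (by simp [impInf])).trans (by simp [impInf])
  · exact (hF (t := {(⊤, ⊥)}) (by simp [impInf])).trans (by simp [impInf])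

end ImpInf

/-! ### Interior operators on free Boolean extensions; extending and restricting homomorphisms -/

section FreeExtension

open InteriorAlgebra

variable {α : Type*} {β : Type*} [HeytingAlgebra α] [InteriorAlgebra β]

/-- `ι` presents the interior algebra `β` as the free Boolean extension `B(α)` of `α`. -/
structure IsFreeExtension (ι : BoundedLatticeHom α β) : Prop where
  le_of_le : ∀ {a b}, ι a ≤ ι b → a ≤ b
  g_imp : ∀ a b, g ((ι a)ᶜ ⊔ ι b) = ι (a ⇨ b)
  exists_eq : ∀ b, ∃ t, b = impInf ι t

theorem g_finset_inf {κ : Type*} (t : Finset κ) (f : κ → β) :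
    g (t.inf f) = t.inf fun i => g (f i) := by
  classical
  induction t using Finset.induction_on with
  | empty => simpa using g_top
  | insert i t _ ih => rw [Finset.inf_insert, Finset.inf_insert, g_inf, ih]

theorem g_mono {a b : β} (h : a ≤ b) : g a ≤ g b := by
  rw [← inf_eq_left, ← g_inf, inf_eq_left.2 h]

namespace IsFreeExtension

variable {ι : BoundedLatticeHom α β} (hι : IsFreeExtension ι)
include hι

theorem injective : Function.Injective ι := fun _ _ h =>
  le_antisymm (hι.le_of_le h.le) (hι.le_of_le h.ge)

theorem g_apply (a : α) : g (ι a) = ι a := by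
  simpa using hι.g_imp ⊤ a

theorem g_impInf (t : Finset (α × α)) : g (impInf ι t) = ι (himps t) := by
  rw [impInf, g_finset_inf, himps, map_finset_inf]
  exact Finset.inf_congr rfl fun p _ => hι.g_imp _ _

theorem exists_of_g_eq {b : β} (hb : g b = b) : ∃ a, ι a = b := by
  obtain ⟨t, rfl⟩ := hι.exists_eq b
  exact ⟨himps t, by rw [← hι.g_impInf, hb]⟩

theorem finite_iff : Finite α ↔ Finite β := by
  refine ⟨fun _ => ?_, fun _ => Finite.of_injective ι hι.injective⟩
  have : Finite (Finset (α × α)) := inferInstance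
  exact Finite.of_surjective (impInf ι) fun b => (hι.exists_eq b).imp fun _ h => h.symm

variable {α' : Type*} {β' : Type*} [HeytingAlgebra α'] [InteriorAlgebra β']
  {ι' : BoundedLatticeHom α' β'} (hι' : IsFreeExtension ι')

theorem hom_ext {F G : BoundedLatticeHom β β'} (h : ∀ a, F (ι a) = G (ι a)) : F = G := by
  ext b
  obtain ⟨t, rfl⟩ := hι.exists_eq b
  simp only [impInf, map_finset_inf]
  refine Finset.inf_congr rfl fun p _ => ?_
  simp [h]

include hι'

/-- The Boolean extension commutes with `g` because `g` replaces each clause by an implication and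
`f` preserves implications. -/
theorem exists_extend (f : HeytingHom α α') : ∃ F : BoundedLatticeHom β β',
    (∀ b, F (g b) = g (F b)) ∧ ∀ a, F (ι a) = ι' (f a) := by
  classical
  obtain ⟨F, hF⟩ := exists_extension hι.le_of_le hι.exists_eq
    (ι'.comp (⟨f, map_top f, map_bot f⟩ : BoundedLatticeHom α α'))
  have hFι : ∀ a, F (ι a) = ι' (f a) := fun a => by
    rw [← impInf_top_left ι, hF, impInf_top_left]; rfl
  refine ⟨F, fun b => ?_, hFι⟩
  obtain ⟨t, rfl⟩ := hι.exists_eq b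
  rw [hι.g_impInf, hFι, hF, impInf, g_finset_inf, himps, map_finset_inf, map_finset_inf]
  refine Finset.inf_congr rfl fun p _ => ?_
  exact (congrArg ι' (map_himp f _ _)).trans (hι'.g_imp _ _).symm

/-- `F` sends open elements to open elements, and in a free extension these are the image of the
Heyting algebra. Implications are preserved as they are `g` of a clause. -/
theorem exists_restrict (F : BoundedLatticeHom β β') (hF : ∀ b, F (g b) = g (F b)) :
    ∃ f : HeytingHom α α', ∀ a, F (ι a) = ι' (f a) := by
  have h : ∀ a, ∃ a', ι' a' = F (ι a) := fun a =>
    hι'.exists_of_g_eq (by rw [← hF, hι.g_apply])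
  choose f hf using h
  refine ⟨{ toFun := f, map_sup' := fun a b => hι'.injective ?_,
            map_inf' := fun a b => hι'.injective ?_, map_bot' := hι'.injective ?_,
            map_himp' := fun a b => hι'.injective ?_ }, fun a => (hf a).symm⟩
  · simp [hf]
  · simp [hf]
  · simp [hf]
  · simp [hf, ← hι'.g_imp, ← hι.g_imp, hF]

theorem surjective_iff {F : BoundedLatticeHom β β'} (hF : ∀ b, F (g b) = g (F b))
    {f : α → α'} (hf : ∀ a, F (ι a) = ι' (f a)) :
    Function.Surjective f ↔ Function.Surjective F := by
  constructor
  · intro h b'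
    obtain ⟨t, rfl⟩ := hι'.exists_eq b'
    choose r hr using h
    refine ⟨t.inf fun p => (ι (r p.1))ᶜ ⊔ ι (r p.2), ?_⟩
    rw [map_finset_inf]
    refine Finset.inf_congr rfl fun p _ => ?_
    simp [hf, hr]
  · intro h a'
    obtain ⟨b, hb⟩ := h (ι' a')
    -- The preimage `b` need not be open, but `g b` is, and it has the same image because `ι' a'` is
    -- open.
    obtain ⟨a, ha⟩ := hι.exists_of_g_eq (g_idem b)
    refine ⟨a, hι'.injective ?_⟩
    rw [← hf, ha, hF, hb, hι'.g_apply]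

end IsFreeExtension

end FreeExtension

/-! ### The Grzegorczyk inequality -/

section Grzegorczyk

open InteriorAlgebra

/-- The embedding of a Heyting algebra into its free Boolean extension. -/
def toFrHom (D : Type u) [HeytingAlgebra D] : BoundedLatticeHom D (Fr D) where
  toFun := toFr
  map_sup' := toFr_sup
  map_inf' := toFr_inf
  map_top' := toFr_top
  map_bot' := toFr_bot

theorem isFreeExtension_toFrHom (D : Type u) [HeytingAlgebra D] :
    IsFreeExtension (toFrHom D) where
  le_of_le := toFr_le_toFr.1
  g_imp a b := by
    have h : (toFr a)ᶜ ⊔ toFr b = conj {(a, b)} := by simp [conj]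
    change toFr (openPart ((toFr a)ᶜ ⊔ toFr b)) = toFr (a ⇨ b)
    rw [h, openPart_conj]
    simp [himps]
  exists_eq := exists_eq_conj

/-- The Grzegorczyk inequality holds in free Boolean extensions of Heyting algebras. -/
theorem IsFreeExtension.grzegorczyk {α β : Type*} [HeytingAlgebra α] [InteriorAlgebra β]
    {ι : BoundedLatticeHom α β} (hι : IsFreeExtension ι) (x : β) :
    g ((g (xᶜ ⊔ g x))ᶜ ⊔ x) ≤ x := by
  classical
  obtain ⟨t, ht⟩ := hι.exists_eq x
  have hx : ∀ {b}, b ≤ x ↔ ∀ p ∈ t, b ≤ (ι p.1)ᶜ ⊔ ι p.2 := fun {b} => by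
    rw [ht, impInf, Finset.le_inf_iff]
  -- Here `b` is open and `s` contains every clause of `x` whose right side is not yet known to lie
  -- above `b`. For `p ∈ s`, shrinking `b` to `b ⊓ ι p.2` removes `p` from `s`, so this open element
  -- is below `x`, hence below `g x`. It follows that `b ⊓ ι p.1` is below `xᶜ ⊔ g x`, and being
  -- open below its interior; so it is below `x`, and the clause `p` then puts it below `ι p.2`.
  have key : ∀ (s : Finset (α × α)) (b : β), g b = b → (∀ p ∈ t, p ∉ s → b ≤ ι p.2) →
      b ⊓ g (xᶜ ⊔ g x) ≤ x → b ≤ x := by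
    intro s
    induction s using Finset.strongInduction with
    | H s ih =>
      intro b hb hs hbx
      refine hx.2 fun p hp => ?_
      by_cases hps : p ∈ s
      · have hop : ∀ a, g (b ⊓ ι a) = b ⊓ ι a := fun a => by rw [g_inf, hb, hι.g_apply]
        have h1 : b ⊓ ι p.2 ≤ x := by
          refine ih _ (Finset.erase_ssubset hps) _ (hop _) (fun q hq hqs => ?_)
            ((inf_le_inf_right _ inf_le_left).trans hbx)
          by_cases hqp : q = p
          · exact hqp ▸ inf_le_right
          · exact inf_le_left.trans (hs q hq fun h => hqs (Finset.mem_erase.2 ⟨hqp, h⟩))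
        have h2 : b ⊓ ι p.2 ≤ g x := (hop _).symm.le.trans (g_mono h1)
        have h3 : b ⊓ ι p.1 ≤ xᶜ ⊔ g x := by
          rw [sup_comm, ← himp_eq, le_himp_iff]
          refine le_trans (le_inf (inf_le_left.trans inf_le_left) ?_) h2
          have h4 := hx.1 le_rfl p hp
          rw [sup_comm, ← himp_eq, le_himp_iff] at h4
          exact (le_inf inf_le_right (inf_le_left.trans inf_le_right)).trans h4
        have h5 : b ⊓ ι p.1 ≤ g (xᶜ ⊔ g x) := (hop _).symm.le.trans (g_mono h3)
        have h6 := hx.1 ((le_inf inf_le_left h5).trans hbx) p hp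
        rw [sup_comm, ← himp_eq, le_himp_iff] at h6 ⊢
        exact (le_inf le_rfl inf_le_right).trans h6
      · exact (hs p hp hps).trans le_sup_right
  -- With `s = t` the condition on the remaining clauses is vacuous.
  refine key t _ (g_idem _) (fun p hp h => absurd hp h) ?_
  rw [← le_himp_iff, himp_eq, sup_comm x]
  exact g_le _

end Grzegorczyk

/-! ### Open elements, and finite algebras generated by them -/

section Opens

open InteriorAlgebra

variable (β : Type u) [InteriorAlgebra β]

/-- The sublattice of open elements of an interior algebra. -/
def opens : Sublattice β where
  carrier := {b | g b = b}
  supClosed' a ha b hb := by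
    refine le_antisymm (g_le _) (sup_le ?_ ?_)
    · exact (show a = g a from ha.symm).le.trans (g_mono le_sup_left)
    · exact (show b = g b from hb.symm).le.trans (g_mono le_sup_right)
  infClosed' a ha b hb := (g_inf a b).trans (congrArg₂ _ ha hb)

variable {β} in
theorem mem_opens {b : β} : b ∈ opens β ↔ g b = b := Iff.rfl

instance : BoundedOrder (opens β) where
  top := ⟨⊤, g_top⟩
  le_top _ := Subtype.coe_le_coe.1 le_top
  bot := ⟨⊥, le_bot_iff.1 (g_le ⊥)⟩
  bot_le _ := Subtype.coe_le_coe.1 bot_le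

/-- The open elements of an interior algebra form a Heyting algebra. -/
instance : HeytingAlgebra (opens β) :=
  HeytingAlgebra.ofHImp (fun a b => ⟨g ((a : β)ᶜ ⊔ b), g_idem _⟩) fun a b c => by
    rw [← Subtype.coe_le_coe, ← Subtype.coe_le_coe, Sublattice.coe_inf, ← le_himp_iff, himp_eq,
      sup_comm]
    exact ⟨fun h => h.trans (g_le _), fun h => (mem_opens.1 a.2).symm.le.trans (g_mono h)⟩

/-- The inclusion of the open elements. -/
def opensHom : BoundedLatticeHom (opens β) β where
  toFun := Subtype.val
  map_sup' _ _ := rfl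
  map_inf' _ _ := rfl
  map_top' := rfl
  map_bot' := rfl

variable {β}

/-- A finite interior algebra satisfying the Grzegorczyk inequality is the free Boolean extension
of its Heyting algebra of open elements. -/
theorem isFreeExtension_opensHom [Finite β]
    (hgrz : ∀ x : β, g ((g (xᶜ ⊔ g x))ᶜ ⊔ x) ≤ x) : IsFreeExtension (opensHom β) where
  le_of_le := id
  g_imp _ _ := rfl
  exists_eq := by
    classical
    -- `C` is the Boolean subalgebra generated by the open elements; it has to be everything.
    set C : Set β := {b | ∃ t, b = impInf (opensHom β) t} with hC
    have hinf : ∀ {a b}, a ∈ C → b ∈ C → a ⊓ b ∈ C := by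
      rintro _ _ ⟨s, rfl⟩ ⟨t, rfl⟩
      exact ⟨_, (impInf_union _ s t).symm⟩
    have hsup : ∀ {a b}, a ∈ C → b ∈ C → a ⊔ b ∈ C := by
      rintro _ _ ⟨s, rfl⟩ ⟨t, rfl⟩
      exact ⟨_, impInf_sup_impInf _ s t⟩
    have hcompl : ∀ {a}, a ∈ C → aᶜ ∈ C := by
      rintro _ ⟨s, rfl⟩
      exact exists_compl_impInf _ s
    have hopen : ∀ a, g a ∈ C := fun a => ⟨_, (impInf_top_left (opensHom β) ⟨g a, g_idem a⟩).symm⟩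
    have htop : ⊤ ∈ C := by simpa [g_top] using hopen ⊤
    have hbot : ⊥ ∈ C := by simpa using hcompl htop
    by_contra! hne
    obtain ⟨a₀, ha₀⟩ := hne
    -- By finiteness there is a minimal `c ∈ C` with some `a ≤ c` outside `C`.
    obtain ⟨c, ⟨hcC, a, hac, haC⟩, hmin⟩ :=
      (Set.toFinite {c | c ∈ C ∧ ∃ a ≤ c, a ∉ C}).exists_minimal
        ⟨⊤, htop, a₀, le_top, fun ⟨t, ht⟩ => ha₀ t ht⟩
    have hlt : ∀ {d}, d ∈ C → d ≤ c → ¬ c ≤ d → ∀ a ≤ d, a ∈ C := fun {d} hd hdc hcd a had =>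
      by_contra fun h => hcd (hmin ⟨hd, a, had, h⟩ hdc)
    -- No open element splits `c`: otherwise both pieces of `c` would be strictly smaller members of
    -- `C`, so both pieces of `a`, and hence `a`, would lie in `C`.
    have hdich : ∀ b, c ≤ g b ∨ c ⊓ g b = ⊥ := by
      intro b
      by_contra! hb
      refine haC ?_
      have h1 : a ⊓ g b ∈ C := hlt (hinf hcC (hopen b)) inf_le_left
        (fun h => hb.1 (h.trans inf_le_right)) _ (inf_le_inf_right _ hac)
      have h2 : a ⊓ (g b)ᶜ ∈ C := hlt (hinf hcC (hcompl (hopen b))) inf_le_left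
        (fun h => hb.2 (disjoint_iff.1
          (le_compl_iff_disjoint_right.1 (h.trans inf_le_right)))) _ (inf_le_inf_right _ hac)
      have h3 := hsup h1 h2
      rwa [← inf_sup_left, sup_compl_eq_top, inf_top_eq] at h3
    have habot : ¬ c ≤ aᶜ := fun h =>
      haC (by rwa [(le_compl_self.1 (hac.trans h))])
    have h1 : c ⊓ g aᶜ = ⊥ := (hdich _).resolve_left fun h => habot (h.trans (g_le _))
    -- If `c` were below this open element it would be below `a ⊔ g aᶜ`, hence below `a` by `h1`,
    -- forcing `a = c ∈ C`.
    have h2 : c ⊓ g (aᶜᶜ ⊔ g aᶜ) = ⊥ := by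
      refine (hdich _).resolve_left fun h => haC ?_
      have h3 : c ≤ (a ⊔ g aᶜ) ⊓ c := le_inf (by simpa using h.trans (g_le _)) le_rfl
      rw [inf_sup_right, inf_comm (g _), h1, sup_bot_eq] at h3
      exact le_antisymm hac (h3.trans inf_le_left) ▸ hcC
    -- As `a ≤ c`, the open element of `h2` misses `a` too. The Grzegorczyk inequality at `aᶜ` then
    -- reads `⊤ ≤ aᶜ`, which is absurd.
    have h3 : (g (aᶜᶜ ⊔ g aᶜ))ᶜ ⊔ aᶜ = ⊤ := by
      rw [← compl_inf, compl_eq_top, inf_comm]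
      exact le_bot_iff.1 ((inf_le_inf_right _ hac).trans h2.le)
    have h4 := hgrz aᶜ
    rw [h3, g_top] at h4
    exact habot (le_top.trans h4)

end Opens

/-! ### Terms -/

section Terms

open InteriorAlgebra

attribute [local instance] heytingStructure interiorStructure

variable {κ : Type*}

/-- The term `s · t`. -/
def infTerm (s t : interiorSig.Term κ) : interiorSig.Term κ :=
  .func (l := 2) InteriorOp.inf ![s, t]

/-- The term `s + t`. -/
def supTerm (s t : interiorSig.Term κ) : interiorSig.Term κ :=
  .func (l := 2) InteriorOp.sup ![s, t]

/-- The term `-t`. -/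
def complTerm (t : interiorSig.Term κ) : interiorSig.Term κ :=
  .func (l := 1) InteriorOp.compl ![t]

/-- The term `g t`. -/
def interiorTerm (t : interiorSig.Term κ) : interiorSig.Term κ :=
  .func (l := 1) InteriorOp.interior ![t]

/-- The term `0`. -/
def botTerm : interiorSig.Term κ := .func (l := 0) InteriorOp.bot ![]

/-- The term `1`. -/
def topTerm : interiorSig.Term κ := .func (l := 0) InteriorOp.top ![]

section Realize

variable {β : Type*} [InteriorAlgebra β] (v : κ → β) (s t : interiorSig.Term κ)

@[simp] theorem realize_infTerm : (infTerm s t).realize v = s.realize v ⊓ t.realize v := rfl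
@[simp] theorem realize_supTerm : (supTerm s t).realize v = s.realize v ⊔ t.realize v := rfl
@[simp] theorem realize_complTerm : (complTerm t).realize v = (t.realize v)ᶜ := rfl
@[simp] theorem realize_interiorTerm : (interiorTerm t).realize v = g (t.realize v) := rfl
@[simp] theorem realize_botTerm : (botTerm : interiorSig.Term κ).realize v = ⊥ := rfl
@[simp] theorem realize_topTerm : (topTerm : interiorSig.Term κ).realize v = ⊤ := rfl

end Realize

/-- Gödel translation of Heyting terms into terms for interior algebras. -/
theorem exists_godelTranslation (t : heytingSig.Term κ) : ∃ t' : interiorSig.Term κ,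
    ∀ (α β : Type u) [HeytingAlgebra α] [InteriorAlgebra β] (ι : BoundedLatticeHom α β),
      IsFreeExtension ι → ∀ (v : κ → β) (w : κ → α), (∀ i, ι (w i) = g (v i)) →
        t'.realize v = ι (t.realize w) := by
  induction t with
  -- Variables become `g x`, so that valuations by non-open elements are covered as well.
  | var i => exact ⟨interiorTerm (.var i), fun α β _ _ ι _ v w h => (h i).symm⟩
  | func f ts ih =>
    choose r hr using ih
    change HeytingOp _ at f
    cases f with
    | bot => exact ⟨botTerm, fun α β _ _ ι _ v w _ => (map_bot ι).symm⟩
    | top => exact ⟨topTerm, fun α β _ _ ι _ v w _ => (map_top ι).symm⟩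
    | inf =>
      refine ⟨infTerm (r 0) (r 1), fun α β _ _ ι hι v w h => ?_⟩
      rw [realize_infTerm, hr _ α β ι hι v w h, hr _ α β ι hι v w h]
      exact (map_inf ι _ _).symm
    | sup =>
      refine ⟨supTerm (r 0) (r 1), fun α β _ _ ι hι v w h => ?_⟩
      rw [realize_supTerm, hr _ α β ι hι v w h, hr _ α β ι hι v w h]
      exact (map_sup ι _ _).symm
    | imp =>
      refine ⟨interiorTerm (supTerm (complTerm (r 0)) (r 1)), fun α β _ _ ι hι v w h => ?_⟩
      rw [realize_interiorTerm, realize_supTerm, realize_complTerm, hr _ α β ι hι v w h,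
        hr _ α β ι hι v w h]
      exact hι.g_imp _ _

end Terms

/-! ### Identities valid in `ρ*(V)` -/

section EquationalTheory

open InteriorAlgebra

attribute [local instance] heytingStructure interiorStructure

instance : heytingSig.IsAlgebraic := fun _ => inferInstanceAs (IsEmpty Empty)

instance : interiorSig.IsAlgebraic := fun _ => inferInstanceAs (IsEmpty Empty)

instance : Finite (Σ n, heytingSig.Functions n) := by
  refine Set.finite_univ_iff.1 (Set.Finite.subset
    (Set.toFinite {⟨0, HeytingOp.bot⟩, ⟨0, HeytingOp.top⟩, ⟨2, HeytingOp.inf⟩, ⟨2, HeytingOp.sup⟩,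
      ⟨2, HeytingOp.imp⟩}) ?_)
  rintro ⟨_, _ | _⟩ - <;> simp

instance : Finite (Σ n, interiorSig.Functions n) := by
  refine Set.finite_univ_iff.1 (Set.Finite.subset
    (Set.toFinite {⟨0, InteriorOp.bot⟩, ⟨0, InteriorOp.top⟩, ⟨2, InteriorOp.inf⟩,
      ⟨2, InteriorOp.sup⟩, ⟨1, InteriorOp.compl⟩, ⟨1, InteriorOp.interior⟩}) ?_)
  rintro ⟨_, _ | _⟩ - <;> simp

variable {V : Set (Bundled.{u} heytingSig.Structure)}

theorem isVariety_rhoStar (V : Set (Bundled.{u} heytingSig.Structure)) : IsVariety (rhoStar V) :=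
  ⟨_, rfl⟩

theorem fr_mem_rhoStar {D : Type u} [HeytingAlgebra D]
    (hD : (⟨D, heytingStructure D⟩ : Bundled.{u} heytingSig.Structure) ∈ V) :
    (⟨Fr D, interiorStructure (Fr D)⟩ : Bundled.{u} interiorSig.Structure) ∈ rhoStar V :=
  fun _ he => he _ ⟨D, inferInstance, hD, rfl⟩

/-- An identity that holds in all free Boolean extensions of members of `V` holds in `ρ*(V)`. -/
theorem realize_eq_of_mem_rhoStar {A : Bundled.{u} interiorSig.Structure} (hA : A ∈ rhoStar V)
    (s t : interiorSig.Term ℕ)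
    (h : ∀ (D : Type u) [HeytingAlgebra D],
      (⟨D, heytingStructure D⟩ : Bundled.{u} heytingSig.Structure) ∈ V →
        ∀ v : ℕ → Fr D, s.realize v = t.realize v)
    (v : ℕ → A) : s.realize v = t.realize v := by
  refine hA (s, t) ?_ v
  rintro _ ⟨D, _, hD, rfl⟩
  exact h D hD

section Operations

variable {M : Type*} [interiorSig.Structure M]

/-- The operation `·` of a structure. -/
def opInf (a b : M) : M := Structure.funMap (L := interiorSig) (n := 2) InteriorOp.inf ![a, b]
/-- The operation `+` of a structure. -/
def opSup (a b : M) : M := Structure.funMap (L := interiorSig) (n := 2) InteriorOp.sup ![a, b]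
/-- The operation `-` of a structure. -/
def opCompl (a : M) : M := Structure.funMap (L := interiorSig) (n := 1) InteriorOp.compl ![a]
/-- The operation `g` of a structure. -/
def opInterior (a : M) : M :=
  Structure.funMap (L := interiorSig) (n := 1) InteriorOp.interior ![a]
/-- The constant `0` of a structure. -/
def opBot : M := Structure.funMap (L := interiorSig) (n := 0) InteriorOp.bot ![]
/-- The constant `1` of a structure. -/
def opTop : M := Structure.funMap (L := interiorSig) (n := 0) InteriorOp.top ![]

variable {κ : Type*} (v : κ → M) (s t : interiorSig.Term κ)

theorem funMap_one {N : Type*} [interiorSig.Structure N] (f : interiorSig.Functions 1)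
    (x : Fin 1 → N) : Structure.funMap f x = Structure.funMap f ![x 0] := by
  congr 1; ext i; fin_cases i; rfl

theorem funMap_two {N : Type*} [interiorSig.Structure N] (f : interiorSig.Functions 2)
    (x : Fin 2 → N) : Structure.funMap f x = Structure.funMap f ![x 0, x 1] := by
  congr 1; ext i; fin_cases i <;> rfl

theorem realize_infTerm' : (infTerm s t).realize v = opInf (s.realize v) (t.realize v) :=
  funMap_two _ _
theorem realize_supTerm' : (supTerm s t).realize v = opSup (s.realize v) (t.realize v) :=
  funMap_two _ _
theorem realize_complTerm' : (complTerm t).realize v = opCompl (t.realize v) := funMap_one _ _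
theorem realize_interiorTerm' : (interiorTerm t).realize v = opInterior (t.realize v) :=
  funMap_one _ _
theorem realize_botTerm' : (botTerm : interiorSig.Term κ).realize v = opBot :=
  congrArg (Structure.funMap (L := interiorSig) InteriorOp.bot) (Subsingleton.elim _ _)
theorem realize_topTerm' : (topTerm : interiorSig.Term κ).realize v = opTop :=
  congrArg (Structure.funMap (L := interiorSig) InteriorOp.top) (Subsingleton.elim _ _)

end Operations

/-- The assignment `x₀ ↦ a`, `x₁ ↦ b`, `x₂ ↦ c`. -/
def assign {M : Type*} (a b c : M) : ℕ → M
  | 0 => a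
  | 1 => b
  | _ => c

/-- Every member of `ρ*(V)` is an interior algebra. -/
theorem exists_interiorAlgebra {A : Bundled.{u} interiorSig.Structure} (hA : A ∈ rhoStar V) :
    ∃ _ : InteriorAlgebra A, A.str = interiorStructure A := by
  let x : interiorSig.Term ℕ := .var 0
  let y : interiorSig.Term ℕ := .var 1
  let z : interiorSig.Term ℕ := .var 2
  -- The axioms of interior algebras, with inequalities written as identities, need at most three
  -- variables and hold in every free Boolean extension.
  have key : ∀ (s t : interiorSig.Term ℕ),
      (∀ (D : Type u) [HeytingAlgebra D] (v : ℕ → Fr D), s.realize v = t.realize v) →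
      ∀ a b c : A, s.realize (assign a b c) = t.realize (assign a b c) := fun s t h a b c =>
    realize_eq_of_mem_rhoStar hA s t (fun D _ _ => h D) _
  have supComm := key (supTerm x y) (supTerm y x) fun D _ v => by
    simp only [realize_supTerm]; exact sup_comm _ _
  have infComm := key (infTerm x y) (infTerm y x) fun D _ v => by
    simp only [realize_infTerm]; exact inf_comm _ _
  have supAssoc := key (supTerm (supTerm x y) z) (supTerm x (supTerm y z)) fun D _ v => by
    simp only [realize_supTerm]; exact sup_assoc _ _ _
  have infAssoc := key (infTerm (infTerm x y) z) (infTerm x (infTerm y z)) fun D _ v => by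
    simp only [realize_infTerm]; exact inf_assoc _ _ _
  have supInf := key (supTerm x (infTerm x y)) x fun D _ v => by
    simp only [realize_supTerm, realize_infTerm]; exact sup_inf_self
  have infSup := key (infTerm x (supTerm x y)) x fun D _ v => by
    simp only [realize_supTerm, realize_infTerm]; exact inf_sup_self
  have distrib := key (supTerm x (infTerm y z)) (infTerm (supTerm x y) (supTerm x z))
    fun D _ v => by simp only [realize_supTerm, realize_infTerm]; exact sup_inf_left _ _ _
  have infCompl := key (infTerm x (complTerm x)) botTerm fun D _ v => by
    simp only [realize_complTerm, realize_infTerm]; exact inf_compl_eq_bot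
  have supCompl := key (supTerm x (complTerm x)) topTerm fun D _ v => by
    simp only [realize_complTerm, realize_supTerm]; exact sup_compl_eq_top
  have supTop := key (supTerm x topTerm) topTerm fun D _ v => by
    simp only [realize_topTerm, realize_supTerm]; exact sup_top_eq _
  have supBot := key (supTerm x botTerm) x fun D _ v => by
    simp only [realize_botTerm, realize_supTerm]; exact sup_bot_eq _
  have gLe := key (supTerm (interiorTerm x) x) x fun D _ v => by
    simp only [realize_interiorTerm, realize_supTerm]; exact sup_eq_right.2 (g_le _)
  have gIdem := key (interiorTerm (interiorTerm x)) (interiorTerm x) fun D _ v => by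
    simp only [realize_interiorTerm]; exact g_idem _
  have gInf := key (interiorTerm (infTerm x y)) (infTerm (interiorTerm x) (interiorTerm y))
    fun D _ v => by simp only [realize_interiorTerm, realize_infTerm]; exact g_inf _ _
  have gTop := key (interiorTerm topTerm) topTerm fun D _ v => by
    simp only [realize_interiorTerm, realize_topTerm]; exact g_top
  simp only [realize_infTerm', realize_supTerm', Term.realize_var, x, y, assign] at supComm infComm
  simp only [realize_supTerm', Term.realize_var, x, y, z, assign] at supAssoc
  simp only [realize_infTerm', Term.realize_var, x, y, z, assign] at infAssoc
  simp only [realize_infTerm', realize_supTerm', Term.realize_var, x, y, assign] at supInf infSup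
  simp only [realize_infTerm', realize_supTerm', Term.realize_var, x, y, z, assign] at distrib
  simp only [realize_infTerm', realize_complTerm', realize_botTerm', Term.realize_var, x,
    assign] at infCompl
  simp only [realize_supTerm', realize_complTerm', realize_topTerm', Term.realize_var, x,
    assign] at supCompl
  simp only [realize_supTerm', realize_topTerm', realize_botTerm', Term.realize_var, x,
    assign] at supTop supBot
  simp only [realize_supTerm', realize_interiorTerm', Term.realize_var, x, assign] at gLe gIdem
  simp only [realize_infTerm', realize_interiorTerm', Term.realize_var, x, y, assign] at gInf
  simp only [realize_interiorTerm', realize_topTerm'] at gTop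
  let _ : Max A := ⟨opSup⟩
  let _ : Min A := ⟨opInf⟩
  let lat : Lattice A := Lattice.mk' (fun a b => supComm a b a) supAssoc
    (fun a b => infComm a b a) infAssoc (fun a b => supInf a b a) (fun a b => infSup a b a)
  let dl : DistribLattice A := { lat with le_sup_inf := fun a b c => (distrib a b c).ge }
  let ba : BooleanAlgebra A :=
    { dl with
      top := opTop
      bot := opBot
      compl := opCompl
      le_top := fun a => sup_eq_right.1 (supTop a a a)
      bot_le := fun a => sup_eq_left.1 (supBot a a a)
      inf_compl_le_bot := fun a => (infCompl a a a).le
      top_le_sup_compl := fun a => (supCompl a a a).ge }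
  let ia : InteriorAlgebra A :=
    { ba with
      g := opInterior
      g_le := fun a => sup_eq_right.1 (gLe a a a)
      g_idem := fun a => gIdem a a a
      g_inf := fun a b => gInf a b a
      g_top := gTop opTop opTop opTop }
  refine ⟨ia, ?_⟩
  refine Structure.ext (funext fun n => funext fun f => funext fun w => ?_)
    (funext fun n => funext fun r => isEmptyElim r)
  change InteriorOp n at f
  cases f with
  | bot =>
    exact congrArg (@Structure.funMap interiorSig A A.str 0 InteriorOp.bot)
      (Subsingleton.elim w ![])
  | top =>
    exact congrArg (@Structure.funMap interiorSig A A.str 0 InteriorOp.top)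
      (Subsingleton.elim w ![])
  | inf => exact @funMap_two A A.str InteriorOp.inf w
  | sup => exact @funMap_two A A.str InteriorOp.sup w
  | compl => exact @funMap_one A A.str InteriorOp.compl w
  | interior => exact @funMap_one A A.str InteriorOp.interior w

/-- Written as an identity `s + x = x`, the inequality passes from the algebras `B(D)` to the
variety they generate. -/
theorem grzegorczyk_of_mem_rhoStar {β : Type u} [InteriorAlgebra β]
    (hβ : (⟨β, interiorStructure β⟩ : Bundled.{u} interiorSig.Structure) ∈ rhoStar V) (a : β) :
    g ((g (aᶜ ⊔ g a))ᶜ ⊔ a) ≤ a := by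
  let x : interiorSig.Term ℕ := .var 0
  have h := realize_eq_of_mem_rhoStar hβ (supTerm (interiorTerm (supTerm (complTerm (interiorTerm
    (supTerm (complTerm x) (interiorTerm x)))) x)) x) x (fun D _ _ v => by
      simp only [realize_interiorTerm, realize_supTerm, realize_complTerm]
      exact sup_eq_right.2 ((isFreeExtension_toFrHom D).grzegorczyk _)) fun _ => a
  exact sup_eq_right.1 h

/-- The Gödel translation of an identity of `V` holds in each `B(D)` with `D ∈ V`, hence in `β`.
Evaluated at open elements it returns the original identity in `α`. -/
theorem mem_of_isFreeExtension (hV : IsVariety V) {α β : Type u} [HeytingAlgebra α]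
    [InteriorAlgebra β] {ι : BoundedLatticeHom α β} (hι : IsFreeExtension ι)
    (hβ : (⟨β, interiorStructure β⟩ : Bundled.{u} interiorSig.Structure) ∈ rhoStar V) :
    (⟨α, heytingStructure α⟩ : Bundled.{u} heytingSig.Structure) ∈ V := by
  obtain ⟨E, rfl⟩ := hV
  intro e he w
  obtain ⟨s, hs⟩ := exists_godelTranslation.{u} e.1
  obtain ⟨t, ht⟩ := exists_godelTranslation.{u} e.2
  have h := realize_eq_of_mem_rhoStar hβ s t (fun D _ hD v => by
    have hw : ∀ i, toFrHom D (openPart (v i)) = g (v i) := fun i => rfl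
    rw [hs D _ _ (isFreeExtension_toFrHom D) v _ hw, ht D _ _ (isFreeExtension_toFrHom D) v _ hw]
    exact congrArg _ (hD e he _)) fun i => ι (w i)
  have hw : ∀ i, ι (w i) = g (ι (w i)) := fun i => (hι.g_apply _).symm
  exact hι.injective ((hs α β ι hι _ w hw).symm.trans (h.trans (ht α β ι hι _ w hw)))

end EquationalTheory

/-! ### Algebras, homomorphisms and unifiers of `V` and of `ρ*(V)` -/

section Correspondence

open InteriorAlgebra

/-- The algebra `B` over the interior signature is the free Boolean extension of the algebra `A`
over the Heyting signature, by means of `ι`. -/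
inductive Corresponds : (A : Bundled.{u} heytingSig.Structure) →
    (B : Bundled.{u} interiorSig.Structure) → (A → B) → Prop
  | intro {α β : Type u} [HeytingAlgebra α] [InteriorAlgebra β] (j : BoundedLatticeHom α β)
      (hj : IsFreeExtension j) :
      Corresponds ⟨α, heytingStructure α⟩ ⟨β, interiorStructure β⟩ j

section Homs

attribute [local instance] heytingStructure interiorStructure

/-- A homomorphism of Heyting algebras as a homomorphism of algebras over the signature. -/
def HeytingHom.toSigHom {α α' : Type*} [HeytingAlgebra α] [HeytingAlgebra α']
    (f : HeytingHom α α') : α →[heytingSig] α' where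
  toFun := f
  map_fun' {n} op x := by
    change HeytingOp n at op
    cases op with
    | bot => exact map_bot f
    | top => exact map_top f
    | inf => exact map_inf f _ _
    | sup => exact map_sup f _ _
    | imp => exact map_himp f _ _
  map_rel' r := isEmptyElim r

/-- A homomorphism over the Heyting signature as a homomorphism of Heyting algebras. -/
def HeytingHom.ofSigHom {α α' : Type*} [HeytingAlgebra α] [HeytingAlgebra α']
    (f : α →[heytingSig] α') : HeytingHom α α' where
  toFun := f
  map_bot' := f.map_fun (n := 0) HeytingOp.bot ![]
  map_inf' a b := f.map_fun (n := 2) HeytingOp.inf ![a, b]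
  map_sup' a b := f.map_fun (n := 2) HeytingOp.sup ![a, b]
  map_himp' a b := f.map_fun (n := 2) HeytingOp.imp ![a, b]

/-- A bounded lattice homomorphism commuting with `g` is a homomorphism over the signature of
interior algebras. -/
def interiorSigHom {β β' : Type*} [InteriorAlgebra β] [InteriorAlgebra β']
    (F : BoundedLatticeHom β β') (hF : ∀ b, F (g b) = g (F b)) : β →[interiorSig] β' where
  toFun := F
  map_fun' {n} op x := by
    change InteriorOp n at op
    cases op with
    | bot => exact map_bot F
    | top => exact map_top F
    | inf => exact map_inf F _ _
    | sup => exact map_sup F _ _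
    | compl => exact map_compl' F _
    | interior => exact hF _
  map_rel' r := isEmptyElim r

/-- The bounded lattice homomorphism underlying a homomorphism over the signature of interior
algebras. -/
def latticeHomOfInteriorSigHom {β β' : Type*} [InteriorAlgebra β] [InteriorAlgebra β']
    (F : β →[interiorSig] β') : BoundedLatticeHom β β' where
  toFun := F
  map_bot' := F.map_fun (n := 0) InteriorOp.bot ![]
  map_top' := F.map_fun (n := 0) InteriorOp.top ![]
  map_inf' a b := F.map_fun (n := 2) InteriorOp.inf ![a, b]
  map_sup' a b := F.map_fun (n := 2) InteriorOp.sup ![a, b]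

theorem interiorSigHom_map_g {β β' : Type*} [InteriorAlgebra β] [InteriorAlgebra β']
    (F : β →[interiorSig] β') (b : β) : F (g b) = g (F b) :=
  F.map_fun (n := 1) InteriorOp.interior ![b]

end Homs

namespace Corresponds

variable {A A' : Bundled.{u} heytingSig.Structure} {B B' : Bundled.{u} interiorSig.Structure}
  {ι : A → B} {ι' : A' → B'}

theorem injective (h : Corresponds A B ι) : Function.Injective ι := by
  obtain ⟨j, hj⟩ := h
  exact hj.injective

theorem finite_iff (h : Corresponds A B ι) : Finite A ↔ Finite B := by
  obtain ⟨j, hj⟩ := h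
  exact hj.finite_iff

theorem exists_extend (h : Corresponds A B ι) (h' : Corresponds A' B' ι') (f : A →[heytingSig] A') :
    ∃ F : B →[interiorSig] B', ∀ a, F (ι a) = ι' (f a) := by
  obtain ⟨j, hj⟩ := h
  obtain ⟨j', hj'⟩ := h'
  obtain ⟨F, hF, hFι⟩ := hj.exists_extend hj' (HeytingHom.ofSigHom f)
  exact ⟨interiorSigHom F hF, hFι⟩

theorem exists_restrict (h : Corresponds A B ι) (h' : Corresponds A' B' ι')
    (F : B →[interiorSig] B') : ∃ f : A →[heytingSig] A', ∀ a, F (ι a) = ι' (f a) := by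
  obtain ⟨j, hj⟩ := h
  obtain ⟨j', hj'⟩ := h'
  obtain ⟨f, hf⟩ := hj.exists_restrict hj' (latticeHomOfInteriorSigHom F) (interiorSigHom_map_g F)
  exact ⟨HeytingHom.toSigHom f, hf⟩

theorem hom_ext (h : Corresponds A B ι) (h' : Corresponds A' B' ι') {F G : B →[interiorSig] B'}
    (hFG : ∀ a, F (ι a) = G (ι a)) : F = G := by
  obtain ⟨j, hj⟩ := h
  obtain ⟨j', hj'⟩ := h'
  have := hj.hom_ext (F := latticeHomOfInteriorSigHom F) (G := latticeHomOfInteriorSigHom G) hFG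
  exact DFunLike.ext _ _ fun b => DFunLike.congr_fun this b

theorem surjective_iff (h : Corresponds A B ι) (h' : Corresponds A' B' ι')
    {F : B →[interiorSig] B'} {f : A →[heytingSig] A'} (hf : ∀ a, F (ι a) = ι' (f a)) :
    Function.Surjective f ↔ Function.Surjective F := by
  obtain ⟨j, hj⟩ := h
  obtain ⟨j', hj'⟩ := h'
  exact hj.surjective_iff hj' (F := latticeHomOfInteriorSigHom F) (interiorSigHom_map_g F) hf

end Corresponds

variable {V : Set (Bundled.{u} heytingSig.Structure)}

theorem exists_corresponds (hHA : V ⊆ HA) {A : Bundled.{u} heytingSig.Structure} (hA : A ∈ V) :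
    ∃ B ∈ rhoStar V, ∃ ι : A → B, Corresponds A B ι := by
  obtain ⟨α, _, rfl⟩ : ∃ (α : Type u) (_ : HeytingAlgebra α), A = ⟨α, heytingStructure α⟩ := by
    obtain ⟨i, h⟩ := hHA hA
    exact ⟨A, i, by rw [← h]⟩
  exact ⟨_, fr_mem_rhoStar hA, _, .intro _ (isFreeExtension_toFrHom α)⟩

/-- The Heyting algebra is that of the open elements. Finiteness is what lets the Grzegorczyk
inequality recover `B` from them. -/
theorem exists_corresponds_of_finite (hV : IsVariety V) {B : Bundled.{u} interiorSig.Structure}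
    (hB : B ∈ rhoStar V) (hfin : Finite B) : ∃ A ∈ V, ∃ ι : A → B, Corresponds A B ι := by
  obtain ⟨β, _, rfl⟩ : ∃ (β : Type u) (_ : InteriorAlgebra β), B = ⟨β, interiorStructure β⟩ := by
    obtain ⟨i, h⟩ := exists_interiorAlgebra hB
    exact ⟨B, i, by rw [← h]⟩
  change Finite β at hfin
  have hι := isFreeExtension_opensHom (β := β) (grzegorczyk_of_mem_rhoStar hB)
  exact ⟨_, mem_of_isFreeExtension hV hι hB, _, .intro _ hι⟩

section

attribute [local instance] heytingStructure interiorStructure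

/-- Implication is a term in the interior operations, so the elements that `ι` sends into a
subalgebra form a Heyting subalgebra; clauses then generate the rest. -/
theorem IsFreeExtension.fg {α β : Type*} [HeytingAlgebra α] [InteriorAlgebra β]
    {ι : BoundedLatticeHom α β} (hι : IsFreeExtension ι) (h : Structure.FG heytingSig α) :
    Structure.FG interiorSig β := by
  classical
  obtain ⟨s, hs, hst⟩ := Structure.fg_iff.1 h
  refine Structure.fg_iff.2 ⟨ι '' s, hs.image _, top_unique fun b _ => ?_⟩
  set S := Substructure.closure interiorSig (ι '' s)
  have hinf : ∀ {a b}, a ∈ S → b ∈ S → a ⊓ b ∈ S := fun {a b} ha hb =>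
    S.fun_mem (n := 2) InteriorOp.inf ![a, b] fun i => by fin_cases i <;> assumption
  have hsup : ∀ {a b}, a ∈ S → b ∈ S → a ⊔ b ∈ S := fun {a b} ha hb =>
    S.fun_mem (n := 2) InteriorOp.sup ![a, b] fun i => by fin_cases i <;> assumption
  have hcompl : ∀ {a}, a ∈ S → aᶜ ∈ S := fun {a} ha =>
    S.fun_mem (n := 1) InteriorOp.compl ![a] fun i => by fin_cases i; assumption
  have hg : ∀ {a}, a ∈ S → g a ∈ S := fun {a} ha =>
    S.fun_mem (n := 1) InteriorOp.interior ![a] fun i => by fin_cases i; assumption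
  have htop : ⊤ ∈ S := S.fun_mem (n := 0) InteriorOp.top ![] fun i => i.elim0
  have hbot : ⊥ ∈ S := S.fun_mem (n := 0) InteriorOp.bot ![] fun i => i.elim0
  let T : heytingSig.Substructure α :=
    { carrier := ι ⁻¹' S
      fun_mem := fun {n} op x hx => by
        change HeytingOp n at op
        change ι _ ∈ S
        cases op with
        | bot => exact (map_bot ι).symm ▸ hbot
        | top => exact (map_top ι).symm ▸ htop
        | inf =>
          change ι (x 0 ⊓ x 1) ∈ S
          rw [map_inf]
          exact hinf (hx 0) (hx 1)
        | sup =>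
          change ι (x 0 ⊔ x 1) ∈ S
          rw [map_sup]
          exact hsup (hx 0) (hx 1)
        | imp => exact hι.g_imp (x 0) (x 1) ▸ hg (hsup (hcompl (hx 0)) (hx 1)) }
  have hT : ∀ a, ι a ∈ S := by
    have : Substructure.closure heytingSig s ≤ T := Substructure.closure_le.2 fun a ha =>
      Substructure.subset_closure ⟨a, ha, rfl⟩
    rw [hst] at this
    exact fun a => this (Substructure.mem_top a)
  obtain ⟨t, rfl⟩ := hι.exists_eq b
  induction t using Finset.induction_on with
  | empty => exact htop
  | insert p t _ ih =>
    rw [impInf_insert]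
    exact hinf (hsup (hcompl (hT _)) (hT _)) (ih trivial)

end

/-- A finitely generated `A` has a finitely generated, hence finite, free Boolean extension, in
which it embeds. -/
theorem isLocallyFinite_of_rhoStar (hHA : V ⊆ HA) (hlf : IsLocallyFinite (rhoStar V)) :
    IsLocallyFinite V := by
  intro A hA hfg
  obtain ⟨B, hB, ι, h⟩ := exists_corresponds hHA hA
  refine h.finite_iff.2 (hlf B hB ?_)
  obtain ⟨j, hj⟩ := h
  exact hj.fg hfg

/-- Only finite lifting problems need testing, and these translate in both directions with
surjectivity kept. Without the reduction to finite algebras, a lifting problem in `ρ*(V)` might not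
come from `V`. -/
theorem Corresponds.isProjective_iff (hV : IsVariety V) (hHA : V ⊆ HA)
    (hlf : IsLocallyFinite (rhoStar V)) {P : Bundled.{u} heytingSig.Structure}
    {Q : Bundled.{u} interiorSig.Structure} {ι : P → Q} (h : Corresponds P Q ι) (hP : P ∈ V)
    (hQ : Q ∈ rhoStar V) (hfin : Finite P) : IsProjective V P ↔ IsProjective (rhoStar V) Q := by
  have hfin' : Finite Q := h.finite_iff.1 hfin
  constructor
  · intro hp
    refine isProjective_of_finite (isVariety_rhoStar V) hlf hQ fun A' hA' B' hB' _ _ F G hF => ?_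
    obtain ⟨A, hA, κ, hκ⟩ := exists_corresponds_of_finite hV hA' inferInstance
    obtain ⟨B, hB, μ, hμ⟩ := exists_corresponds_of_finite hV hB' inferInstance
    obtain ⟨f, hf⟩ := hκ.exists_restrict hμ F
    obtain ⟨k, hk⟩ := h.exists_restrict hμ G
    obtain ⟨l, hl⟩ := hp.2 A hA B hB f k ((hκ.surjective_iff hμ hf).2 hF)
    obtain ⟨H, hH⟩ := h.exists_extend hκ l
    refine ⟨H, h.hom_ext hμ fun a => ?_⟩
    rw [hk, Hom.comp_apply, hH, hf, ← hl, Hom.comp_apply]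
  · intro hq
    refine isProjective_of_finite hV (isLocallyFinite_of_rhoStar hHA hlf) hP
      fun A hA B hB _ _ f k hf => ?_
    obtain ⟨A', hA', κ, hκ⟩ := exists_corresponds hHA hA
    obtain ⟨B', hB', μ, hμ⟩ := exists_corresponds hHA hB
    obtain ⟨F, hF⟩ := hκ.exists_extend hμ f
    obtain ⟨G, hG⟩ := h.exists_extend hμ k
    obtain ⟨H, hH⟩ := hq.2 A' hA' B' hB' F G ((hκ.surjective_iff hμ hF).1 hf)
    obtain ⟨l, hl⟩ := h.exists_restrict hκ H
    refine ⟨l, ?_⟩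
    ext a
    apply hμ.injective
    rw [← hG, ← hH, Hom.comp_apply, Hom.comp_apply, hl, hF]

/-- Two unifiers of corresponding algebras correspond to each other. -/
def UnifiersCorrespond {A : Bundled.{u} heytingSig.Structure}
    {A' : Bundled.{u} interiorSig.Structure} (ι : A → A') (x : Unifier V A)
    (y : Unifier (rhoStar V) A') : Prop :=
  ∃ κ : x.B → y.B, Corresponds x.B y.B κ ∧ ∀ a, y.u (ι a) = κ (x.u a)

namespace Corresponds

variable {A : Bundled.{u} heytingSig.Structure} {A' : Bundled.{u} interiorSig.Structure}
  {ι : A → A'}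

theorem unifier_le_iff (h : Corresponds A A' ι) {x x' : Unifier V A}
    {y y' : Unifier (rhoStar V) A'} (hxy : UnifiersCorrespond ι x y)
    (hxy' : UnifiersCorrespond ι x' y') : x ≤ x' ↔ y ≤ y' := by
  obtain ⟨κ, hκ, hxy⟩ := hxy
  obtain ⟨κ', hκ', hxy'⟩ := hxy'
  constructor
  · rintro ⟨k, hk⟩
    obtain ⟨H, hH⟩ := hκ'.exists_extend hκ k
    refine ⟨H, h.hom_ext hκ fun a => ?_⟩
    rw [hxy, Hom.comp_apply, hxy', hH, hk, Hom.comp_apply]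
  · rintro ⟨H, hH⟩
    obtain ⟨k, hk⟩ := hκ'.exists_restrict hκ H
    refine ⟨k, ?_⟩
    ext a
    apply hκ.injective
    rw [← hxy, hH, Hom.comp_apply, Hom.comp_apply, ← hk, hxy']

theorem exists_unifier (hV : IsVariety V) (hHA : V ⊆ HA) (hlf : IsLocallyFinite (rhoStar V))
    (h : Corresponds A A' ι) (x : Unifier V A) :
    ∃ y : Unifier (rhoStar V) A', UnifiersCorrespond ι x y := by
  obtain ⟨hx, hfin⟩ := (isFinitelyPresented_iff_finite hV
    (isLocallyFinite_of_rhoStar hHA hlf)).1 x.finitelyPresented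
  obtain ⟨C, hC, κ, hκ⟩ := exists_corresponds hHA hx
  obtain ⟨F, hF⟩ := h.exists_extend hκ x.u
  exact ⟨⟨C, (isFinitelyPresented_iff_finite (isVariety_rhoStar V) hlf).2
    ⟨hC, hκ.finite_iff.1 hfin⟩, (hκ.isProjective_iff hV hHA hlf hx hC hfin).1 x.projective, F⟩,
    κ, hκ, hF⟩

theorem exists_unifier' (hV : IsVariety V) (hHA : V ⊆ HA) (hlf : IsLocallyFinite (rhoStar V))
    (h : Corresponds A A' ι) (y : Unifier (rhoStar V) A') :
    ∃ x : Unifier V A, UnifiersCorrespond ι x y := by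
  obtain ⟨hy, hfin⟩ :=
    (isFinitelyPresented_iff_finite (isVariety_rhoStar V) hlf).1 y.finitelyPresented
  obtain ⟨C, hC, κ, hκ⟩ := exists_corresponds_of_finite hV hy hfin
  obtain ⟨f, hf⟩ := h.exists_restrict hκ y.u
  have hfin' := hκ.finite_iff.2 hfin
  exact ⟨⟨C, (isFinitelyPresented_iff_finite hV (isLocallyFinite_of_rhoStar hHA hlf)).2
    ⟨hC, hfin'⟩, (hκ.isProjective_iff hV hHA hlf hC hy hfin').2 y.projective, f⟩, κ, hκ, hf⟩

theorem nonempty_unifier_iff (hV : IsVariety V) (hHA : V ⊆ HA)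
    (hlf : IsLocallyFinite (rhoStar V)) (h : Corresponds A A' ι) :
    Nonempty (Unifier V A) ↔ Nonempty (Unifier (rhoStar V) A') :=
  ⟨fun ⟨x⟩ => ⟨(h.exists_unifier hV hHA hlf x).choose⟩,
    fun ⟨y⟩ => ⟨(h.exists_unifier' hV hHA hlf y).choose⟩⟩

/-- Corresponding algebras have the same unification type. -/
theorem qoHasType_iff (hV : IsVariety V) (hHA : V ⊆ HA) (hlf : IsLocallyFinite (rhoStar V))
    (h : Corresponds A A' ι) (τ : UnificationType) :
    QOHasType (Unifier V A) τ ↔ QOHasType (Unifier (rhoStar V) A') τ :=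
  qoHasType_congr (R := UnifiersCorrespond ι) h.unifier_le_iff (h.exists_unifier hV hHA hlf)
    (h.exists_unifier' hV hHA hlf) τ

end Corresponds

theorem unificationType_eq_unificationType_rhoStar (hV : IsVariety V) (hHA : V ⊆ HA)
    (hlf : IsLocallyFinite (rhoStar V)) : unificationType V = unificationType (rhoStar V) := by
  have hW := isVariety_rhoStar V
  have hlfV := isLocallyFinite_of_rhoStar hHA hlf
  refine unificationType_congr (fun A hA => ?_) fun B hB => ?_
  · obtain ⟨hAV, hfin⟩ := (isFinitelyPresented_iff_finite hV hlfV).1 hA.1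
    obtain ⟨B, hB, ι, h⟩ := exists_corresponds hHA hAV
    exact ⟨B, ⟨(isFinitelyPresented_iff_finite hW hlf).2 ⟨hB, h.finite_iff.1 hfin⟩,
      (h.nonempty_unifier_iff hV hHA hlf).1 hA.2⟩, h.qoHasType_iff hV hHA hlf⟩
  · obtain ⟨hBW, hfin⟩ := (isFinitelyPresented_iff_finite hW hlf).1 hB.1
    obtain ⟨A, hA, ι, h⟩ := exists_corresponds_of_finite hV hBW hfin
    exact ⟨A, ⟨(isFinitelyPresented_iff_finite hV hlfV).2 ⟨hA, h.finite_iff.2 hfin⟩,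
      (h.nonempty_unifier_iff hV hHA hlf).2 hB.2⟩, h.qoHasType_iff hV hHA hlf⟩

end Correspondence

end UnifType

theorem mainTheorem2 (V : Set (CategoryTheory.Bundled.{u} UnifType.heytingSig.Structure))
    (hV : UnifType.IsVariety V) (hHA : V ⊆ UnifType.HA)
    (hlf : UnifType.IsLocallyFinite (UnifType.rhoStar V)) :
    UnifType.unificationType V = UnifType.unificationType (UnifType.rhoStar V) :=
  UnifType.unificationType_eq_unificationType_rhoStar hV hHA hlf
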